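/- **Theorem (Convergence of SPDHG).** Let $X, Y_1,\dots,Y_n$ be real separable Hilbert spaces, $Y=\prod_{i=1}^n Y_i$ with the product Hilbert norm, $A_i:X\to Y_i$ bounded linear operators, and $g:X\to\mathbb{R}\cup\{\infty\}$, $f_i:Y_i\to\mathbb{R}\cup\{\infty\}$ convex, proper and lower semicontinuous. Let $f_i^*(y)=\sup_x\langle x,y\rangle-f_i(x)$ and $$L(x,y)=\sum_{i=1}^n\big(\langle A_ix,y_i\rangle-f_i^*(y_i)\big)+g(x),$$ and call $(\hat x,\hat y)\in X\times Y$ a saddle point if $L(\hat x,y)\le L(x,\hat y)$ for all $x\in X$, $y\in Y$. Assume that a saddle point exists. Let $\tau,\sigma_1,\dots,\sigma_n>0$, write $\mathrm{prox}_h(v)=\arg\min_u\{\tfrac12\|v-u\|^2+h(u)\}$, and assume that $\mathrm{prox}_{\tau g}$ and all $\mathrm{prox}_{\sigma_if_i^*}$ are weakly sequentially continuous. Let $\mathbb{S}^0,\mathbb{S}^1,\dots$ be independent, identically distributed random subsets of $\{1,\dots,n\}$, on a probability space, with $p_i:=\mathbb{P}(i\in\mathbb{S}^0)>0$ for all $i$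 (a proper sampling). Put $C_i=\tau^{1/2}\sigma_i^{1/2}A_i$; for $\mathcal{S}\subset\{1,\dots,n\}$ let $C_{\mathcal{S}}:X\to Y$ be given by $(C_{\mathcal{S}}x)_i=C_ix$ if $i\in\mathcal{S}$ and $0$ otherwise; let $(Qy)_i=p_i^{-1}y_i$ and $$D=Q\,\mathbb{E}\big(C_{\mathbb{S}^0}C_{\mathbb{S}^0}^*\big)\,Q .$$ Assume $\|D\|<1$ (operator norm on $Y$). Given any $x^0\in X$, $y^0\in Y$, set $z^0=\bar z^0=\sum_iA_i^*y_i^0$ and, for $k\ge0$, $$x^{k+1}=\mathrm{prox}_{\tau g}(x^k-\tau\bar z^k),\qquad y_i^{k+1}=\begin{cases}\mathrm{prox}_{\sigma_if_i^*}(y_i^k+\sigma_iA_ix^{k+1})& i\in\mathbb{S}^k,\\ y_i^k&\text{else,}\end{cases}$$ $$\delta_i=A_i^*(y_i^{k+1}-y_i^k),\qquad z^{k+1}=z^k+\sum_{i\in\mathbb{S}^k}\delta_i,\qquad \bar z^{k+1}=z^{k+1}+\theta\sum_{i\in\mathbb{S}^k}p_i^{-1}\delta_i$$ with $\theta=1$.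 Then $(x^k,y^k)$ converges weakly almost surely to a saddle point: there is a random variable $\hat w$ with values in the set of saddle points such that, for almost every $\omega$, $(x^k(\omega),y^k(\omega))$ converges weakly to $\hat w(\omega)$ in $X\times Y$. -/

import Mathlib

open MeasureTheory ProbabilityTheory Filter Topology
open scoped InnerProductSpace

noncomputable section

namespace SPDHG

/-- A sequence converges weakly: it converges in the weak topology. -/
def WeakTendsto {E : Type*} [NormedAddCommGroup E] [NormedSpace ℝ E] (v : ℕ → E) (v' : E) : Prop :=
  Tendsto (fun k => toWeakSpace ℝ E (v k)) atTop (𝓝 (toWeakSpace ℝ E v'))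

/-- `T` maps weakly convergent sequences to weakly convergent sequences, with the right limit. -/
def WeaklySeqContinuous {E : Type*} [NormedAddCommGroup E] [NormedSpace ℝ E] (T : E → E) : Prop :=
  ∀ (v : ℕ → E) (v' : E), WeakTendsto v v' → WeakTendsto (fun k => T (v k)) (T v')

/-- Convex, proper, lower semicontinuous functionals with values in `ℝ ∪ {∞}`; the value `⊥ = -∞`
is excluded by `ne_bot`. -/
structure IsProperConvexLSC {E : Type*} [NormedAddCommGroup E] [NormedSpace ℝ E]
    (f : E → EReal) : Prop where
  ne_bot : ∀ x, f x ≠ ⊥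
  proper : ∃ x, f x ≠ ⊤
  convex : ∀ (x y : E) (a b : ℝ), 0 ≤ a → 0 ≤ b → a + b = 1 →
    f (a • x + b • y) ≤ (a : EReal) * f x + (b : EReal) * f y
  lsc : LowerSemicontinuous f

section Functionals

variable {E : Type*} [NormedAddCommGroup E] [InnerProductSpace ℝ E]

/-- The convex conjugate `f^*(y) = sup_x ⟨x, y⟩ - f(x)`. -/
def conjugate (f : E → EReal) (y : E) : EReal :=
  ⨆ x : E, ((⟪x, y⟫_ℝ : ℝ) : EReal) - f x

/-- The functional `‖v - u‖² / 2 + h(u)` of `u`. -/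
def proxObjective (h : E → EReal) (v u : E) : EReal :=
  ((‖v - u‖ ^ 2 / 2 : ℝ) : EReal) + h u

open Classical in
/-- The proximity operator `prox_h(v) = argmin_u ‖v - u‖² / 2 + h(u)`. The minimizer exists and is
unique for convex, proper, lower semicontinuous `h` on a Hilbert space; the value `v` is used if
there is no minimizer. -/
def prox (h : E → EReal) (v : E) : E :=
  if hu : ∃ u, IsMinOn (proxObjective h v) Set.univ u then hu.choose else v

/-- The functional `c h` for a real number `c`. -/
def scale (c : ℝ) (h : E → EReal) (u : E) : EReal := (c : EReal) * h u

end Functionals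

section Problem

variable {n : ℕ} {X : Type*} [NormedAddCommGroup X] [InnerProductSpace ℝ X]
  {Y : Fin n → Type*} [∀ i, NormedAddCommGroup (Y i)] [∀ i, InnerProductSpace ℝ (Y i)]

/-- `L(x, y) = ∑ i, (⟨A_i x, y_i⟩ - f_i^*(y_i)) + g(x)`. -/
def lagrangian (A : ∀ i, X →L[ℝ] Y i) (f : ∀ i, Y i → EReal) (g : X → EReal)
    (x : X) (y : PiLp 2 Y) : EReal :=
  (∑ i, (((⟪A i x, y i⟫_ℝ : ℝ) : EReal) - conjugate (f i) (y i))) + g x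

/-- `w = (x, y)` is a saddle point: `L(x, y') ≤ L(x', y)` for all `x'`, `y'`; equivalently, `x`
minimizes `L(·, y)` and `y` maximizes `L(x, ·)`. -/
def IsSaddlePoint (A : ∀ i, X →L[ℝ] Y i) (f : ∀ i, Y i → EReal) (g : X → EReal)
    (w : X × PiLp 2 Y) : Prop :=
  IsSaddlePointOn Set.univ Set.univ (lagrangian A f g) w.1 w.2

/-- The operator `A_s : X → Y`, `(A_s x)_i = A_i x` if `i ∈ s` and `0` otherwise. -/
def restrictedOp (A : ∀ i, X →L[ℝ] Y i) (s : Finset (Fin n)) : X →L[ℝ] PiLp 2 Y :=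
  (PiLp.continuousLinearEquiv 2 ℝ Y).symm.toContinuousLinearMap ∘L
    ContinuousLinearMap.pi (fun i => if i ∈ s then A i else 0)

/-- The operator `Q : Y → Y`, `(Q y)_i = p_i⁻¹ y_i`. -/
def weightOp (Y : Fin n → Type*) [∀ i, NormedAddCommGroup (Y i)]
    [∀ i, InnerProductSpace ℝ (Y i)] (p : Fin n → ℝ) : PiLp 2 Y →L[ℝ] PiLp 2 Y :=
  (PiLp.continuousLinearEquiv 2 ℝ Y).symm.toContinuousLinearMap ∘L
    ContinuousLinearMap.pi (fun i => (p i)⁻¹ • PiLp.proj 2 Y i)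

end Problem

section Sampling

variable {n : ℕ} {Ω : Type*} [MeasurableSpace Ω]

/-- `p_i = ℙ(i ∈ S)`. -/
def inclusionProb (P : Measure Ω) (S : Ω → Finset (Fin n)) (i : Fin n) : ℝ :=
  P.real {ω | i ∈ S ω}

variable {X : Type*} [NormedAddCommGroup X] [InnerProductSpace ℝ X] [CompleteSpace X]
  {Y : Fin n → Type*} [∀ i, NormedAddCommGroup (Y i)] [∀ i, InnerProductSpace ℝ (Y i)]
  [∀ i, CompleteSpace (Y i)]

/-- The step size operator `D = Q 𝔼(C_S C_S^*) Q` with `C_i = τ^{1/2} σ_i^{1/2} A_i`. -/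
def stepSizeOp (P : Measure Ω) (S : Ω → Finset (Fin n)) (A : ∀ i, X →L[ℝ] Y i)
    (τ : ℝ) (σ : Fin n → ℝ) : PiLp 2 Y →L[ℝ] PiLp 2 Y :=
  let C : ∀ i, X →L[ℝ] Y i := fun i => (√τ * √(σ i)) • A i
  let Q : PiLp 2 Y →L[ℝ] PiLp 2 Y := weightOp Y (inclusionProb P S)
  Q ∘L (∫ ω, restrictedOp C (S ω) ∘L ContinuousLinearMap.adjoint (restrictedOp C (S ω)) ∂P) ∘L Q

end Sampling

section Algorithm

variable {n : ℕ}

/-- The variables `x^k, y^k, z^k, z̄^k` of the algorithm. -/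
structure State (X : Type*) (Y : Fin n → Type*) where
  x : X
  y : PiLp 2 Y
  z : X
  zbar : X

variable {X : Type*} [NormedAddCommGroup X] [InnerProductSpace ℝ X] [CompleteSpace X]
  {Y : Fin n → Type*} [∀ i, NormedAddCommGroup (Y i)] [∀ i, InnerProductSpace ℝ (Y i)]
  [∀ i, CompleteSpace (Y i)]

/-- The initial state `x^0, y^0, z^0 = z̄^0 = A^* y^0`, where `A^* y = ∑ i, A_i^* y_i`. -/
def initState (A : ∀ i, X →L[ℝ] Y i) (x₀ : X) (y₀ : PiLp 2 Y) : State X Y where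
  x := x₀
  y := y₀
  z := ∑ i, ContinuousLinearMap.adjoint (A i) (y₀ i)
  zbar := ∑ i, ContinuousLinearMap.adjoint (A i) (y₀ i)

/-- One iteration of the algorithm with selected index set `s`, extrapolation parameter `θ`, step
sizes `τ, σ_i` and probabilities `p_i`. -/
def step (A : ∀ i, X →L[ℝ] Y i) (f : ∀ i, Y i → EReal) (g : X → EReal) (τ : ℝ) (σ : Fin n → ℝ)
    (θ : ℝ) (p : Fin n → ℝ) (s : Finset (Fin n)) (w : State X Y) : State X Y :=
  let x' : X := prox (scale τ g) (w.x - τ • w.zbar)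
  let y' : PiLp 2 Y := WithLp.toLp 2 (fun i =>
    if i ∈ s then prox (scale (σ i) (conjugate (f i))) (w.y i + σ i • A i x') else w.y i)
  let δ : Fin n → X := fun i => ContinuousLinearMap.adjoint (A i) (y' i - w.y i)
  let z' : X := w.z + ∑ i ∈ s, δ i
  { x := x'
    y := y'
    z := z'
    zbar := z' + θ • ∑ i ∈ s, (p i)⁻¹ • δ i }

/-- The state after `k` iterations of SPDHG, with index set `s k` selected in iteration `k`. -/
def iterate (A : ∀ i, X →L[ℝ] Y i) (f : ∀ i, Y i → EReal) (g : X → EReal) (τ : ℝ)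
    (σ : Fin n → ℝ) (θ : ℝ) (p : Fin n → ℝ) (x₀ : X) (y₀ : PiLp 2 Y)
    (s : ℕ → Finset (Fin n)) : ℕ → State X Y
  | 0 => initState A x₀ y₀
  | k + 1 => step A f g τ σ θ p (s k) (iterate A f g τ σ θ p x₀ y₀ s k)

end Algorithm

end SPDHG

end

/-! Saddle points are the pairs with `-A^* y ∈ ∂g(x)` and `A_i x ∈ ∂f_i^*(y_i)`
(`isSaddlePoint_iff`). A proximal step yields subgradients of the same functionals, so monotonicity
of subdifferentials bounds the distances to a saddle point `u` after a full step
(`energy_estimate`), up to two cross terms: `⟪x' - u.1, A^* d⟫` with the full dual increment `d`,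
and `⟪x' - u.1, zbar - z⟫`. Only the components in the random set move, but the weights `1 / p_i`
make the expected change of the dual distances and the expected extrapolation equal to those of the
full step. With `θ = 1` the next `zbar - z` therefore has mean `A^* d`, which matches the first
cross term and lets it be carried inside `lyapunov`. The remaining errors are quadratic; they are
absorbed by the step lengths because `‖D‖ ≤ γ ^ 2` with `γ < 1`. On average `lyapunov` drops by at
least `(1 - γ) / 2` times `stepLength` (`sum_prob_mul_lyapunov_step_le`).

Supermartingale convergence (`ae_tendsto_randomIteration`) then shows that almost surely the
Lyapunov values converge and the step lengths vanish. The null set depends on `u`, so `u` is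
restricted to a countable dense set of saddle points. On a good trajectory the iterates are bounded,
and weak sequential continuity of the proximity operators makes every weak cluster point a fixed
point, hence a saddle point (`isSaddlePoint_of_weakTendsto`). Opial's argument
(`exists_weakTendsto_of_tendsto_bilin`) leaves only one cluster point. Finally, the limit is
corrected on a null set to be measurable. -/

namespace SPDHG

/-! ### Convex analysis: proximity operators, subgradients, conjugates -/

section ConvexAnalysis

variable {E : Type*} [NormedAddCommGroup E] [InnerProductSpace ℝ E]

theorem IsProperConvexLSC.eq_top_or_coe {h : E → EReal} (hh : IsProperConvexLSC h) (u : E) :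
    h u = ⊤ ∨ ∃ r : ℝ, h u = r := by
  induction hu : h u with
  | bot => exact absurd hu (hh.ne_bot u)
  | top => exact Or.inl rfl
  | coe r => exact Or.inr ⟨r, rfl⟩

theorem IsProperConvexLSC.exists_coe {h : E → EReal} (hh : IsProperConvexLSC h) :
    ∃ (u : E) (r : ℝ), h u = r := by
  obtain ⟨u, hu⟩ := hh.proper
  obtain h1 | ⟨r, hr⟩ := hh.eq_top_or_coe u
  · exact absurd h1 hu
  · exact ⟨u, r, hr⟩

theorem IsProperConvexLSC.le_coe_of_eq_coe {h : E → EReal} (hh : IsProperConvexLSC h)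
    {u w : E} {r s : ℝ} (hu : h u = r) (hw : h w = s) {a b : ℝ} (ha : 0 ≤ a) (hb : 0 ≤ b)
    (hab : a + b = 1) : h (a • u + b • w) ≤ ((a * r + b * s : ℝ) : EReal) := by
  have := hh.convex u w a b ha hb hab
  rw [hu, hw] at this
  exact_mod_cast this

theorem IsProperConvexLSC.scale {h : E → EReal} (hh : IsProperConvexLSC h) {c : ℝ} (hc : 0 < c) :
    IsProperConvexLSC (scale c h) where
  ne_bot x := by
    obtain hx | ⟨r, hr⟩ := hh.eq_top_or_coe x
    · simp [SPDHG.scale, hx, EReal.coe_mul_top_of_pos hc]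
    · simp only [SPDHG.scale, hr, ← EReal.coe_mul]; exact EReal.coe_ne_bot _
  proper := by
    obtain ⟨u, r, hr⟩ := hh.exists_coe
    exact ⟨u, by simp only [SPDHG.scale, hr, ← EReal.coe_mul]; exact EReal.coe_ne_top _⟩
  convex x y a b ha hb hab := by
    have hc' : (0 : EReal) ≤ (c : EReal) := by exact_mod_cast hc.le
    have := mul_le_mul_of_nonneg_left (hh.convex x y a b ha hb hab) hc'
    rw [EReal.left_distrib_of_nonneg_of_ne_top hc' (EReal.coe_ne_top c)] at this
    refine this.trans (le_of_eq ?_)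
    simp only [SPDHG.scale]
    rw [mul_left_comm, mul_left_comm (c : EReal) (b : EReal)]
  lsc := by
    have hcont : Continuous fun y : EReal => (c : EReal) * y := by
      rw [continuous_iff_continuousAt]
      intro y
      exact EReal.Tendsto.const_mul (f := 𝓝 y) tendsto_id
        (Or.inl (EReal.coe_ne_bot c)) (Or.inl (EReal.coe_ne_top c))
    exact hcont.comp_lowerSemicontinuous hh.lsc
      (fun x y hxy => mul_le_mul_of_nonneg_left hxy (by exact_mod_cast hc.le))

/-- A proper convex lower semicontinuous functional is bounded below by a function of linear
decay. -/
theorem IsProperConvexLSC.exists_linear_lower_bound {h : E → EReal} (hh : IsProperConvexLSC h) :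
    ∃ (x₀ : E) (a b : ℝ), 0 ≤ b ∧ ∀ u, ((a - b * ‖u - x₀‖ : ℝ) : EReal) ≤ h u := by
  obtain ⟨x₀, r₀, hr₀⟩ := hh.exists_coe
  have hlt : ((r₀ - 1 : ℝ) : EReal) < h x₀ := by rw [hr₀]; exact_mod_cast sub_one_lt r₀
  obtain ⟨ε, hε, hball⟩ := Metric.eventually_nhds_iff.1 (hh.lsc x₀ _ hlt)
  refine ⟨x₀, r₀ - 1, 2 / ε, by positivity, fun u => ?_⟩
  obtain hu | ⟨s, hs⟩ := hh.eq_top_or_coe u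
  · rw [hu]; exact le_top
  rw [hs]
  by_cases hd : ‖u - x₀‖ < ε
  · have h1 : ((r₀ - 1 : ℝ) : EReal) < h u := hball (by rwa [dist_eq_norm])
    rw [hs] at h1
    have h2 : r₀ - 1 < s := by exact_mod_cast h1
    have h3 : 0 ≤ 2 / ε * ‖u - x₀‖ := by positivity
    exact_mod_cast (by linarith : r₀ - 1 - 2 / ε * ‖u - x₀‖ ≤ s)
  · push Not at hd
    have hpos : 0 < ‖u - x₀‖ := hε.trans_le hd
    -- This puts `t • u + (1 - t) • x₀` at distance `ε / 2` from `x₀`, inside the ball where `h > r₀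
    -- - 1`; convexity carries the bound out to `u`.
    set t : ℝ := ε / (2 * ‖u - x₀‖) with ht
    have ht0 : 0 < t := by positivity
    have ht1 : t ≤ 1 := by rw [ht, div_le_one (by positivity)]; linarith
    have h1 := hh.le_coe_of_eq_coe hs hr₀ ht0.le (sub_nonneg.2 ht1) (by ring)
    have h2 := hball (y := t • u + (1 - t) • x₀) (by
      have : t • u + (1 - t) • x₀ - x₀ = t • (u - x₀) := by module
      rw [dist_eq_norm, this, norm_smul, Real.norm_of_nonneg ht0.le, ht]
      have : ε / (2 * ‖u - x₀‖) * ‖u - x₀‖ = ε / 2 := by field_simp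
      linarith)
    have h3 : r₀ - 1 < t * s + (1 - t) * r₀ := by exact_mod_cast h2.trans_le h1
    have h4 : 2 / ε * ‖u - x₀‖ * t = 1 := by rw [ht]; field_simp
    have h5 : r₀ - 2 / ε * ‖u - x₀‖ < s := by
      have : t * (r₀ - 2 / ε * ‖u - x₀‖) < t * s := by nlinarith
      exact lt_of_mul_lt_mul_left this ht0.le
    exact_mod_cast (by linarith : r₀ - 1 - 2 / ε * ‖u - x₀‖ ≤ s)

theorem proxObjective_of_eq_coe {E : Type*} [NormedAddCommGroup E] {h : E → EReal} {v u : E} {r : ℝ} (hu : h u = r) :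
    proxObjective h v u = ((‖v - u‖ ^ 2 / 2 + r : ℝ) : EReal) := by
  rw [proxObjective, hu]; norm_cast

theorem norm_sub_midpoint_sq (v u w : E) :
    ‖v - ((1 / 2 : ℝ) • u + (1 / 2 : ℝ) • w)‖ ^ 2
      = ‖v - u‖ ^ 2 / 2 + ‖v - w‖ ^ 2 / 2 - ‖u - w‖ ^ 2 / 4 := by
  have h1 : v - ((1 / 2 : ℝ) • u + (1 / 2 : ℝ) • w)
      = (1 / 2 : ℝ) • ((v - u) + (v - w)) := by module
  have h2 : u - w = (v - w) - (v - u) := by abel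
  rw [h1, h2, norm_smul, mul_pow, norm_add_sq_real, norm_sub_sq_real (v - w),
    real_inner_comm (v - u) (v - w)]
  norm_num
  ring

/-- Strong convexity of the quadratic term makes a minimizing sequence Cauchy, and lower
semicontinuity passes to its limit, so no weak compactness is needed. -/
theorem IsProperConvexLSC.exists_isMinOn_proxObjective [CompleteSpace E] {h : E → EReal}
    (hh : IsProperConvexLSC h) (v : E) :
    ∃ u, IsMinOn (proxObjective h v) Set.univ u := by
  obtain ⟨x₀, a, b, hb, hlow⟩ := hh.exists_linear_lower_bound
  obtain ⟨u₀, r₀, hu₀⟩ := hh.exists_coe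
  set R : Set ℝ := {t | ∃ (u : E) (r : ℝ), h u = r ∧ t = ‖v - u‖ ^ 2 / 2 + r} with hR
  have hne : R.Nonempty := ⟨_, u₀, r₀, hu₀, rfl⟩
  -- The quadratic beats the linear decay of `h`: `t ^ 2 / 2 - b * t ≥ -b ^ 2 / 2`.
  have hbdd : BddBelow R := by
    refine ⟨a - b * ‖v - x₀‖ - b ^ 2 / 2, ?_⟩
    rintro t ⟨u, r, hr, rfl⟩
    have h1 := hlow u
    rw [hr] at h1
    have h2 : a - b * ‖u - x₀‖ ≤ r := by exact_mod_cast h1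
    have h3 : ‖u - x₀‖ ≤ ‖v - u‖ + ‖v - x₀‖ := by
      have := norm_sub_le_norm_sub_add_norm_sub u v x₀
      rwa [norm_sub_rev u v] at this
    nlinarith [mul_le_mul_of_nonneg_left h3 hb, sq_nonneg (‖v - u‖ - b)]
  set m := sInf R with hm
  have hmle : ∀ (u : E) (r : ℝ), h u = r → m ≤ ‖v - u‖ ^ 2 / 2 + r :=
    fun u r hr => csInf_le hbdd ⟨u, r, hr, rfl⟩
  have hseq : ∀ k : ℕ, ∃ (u : E) (r : ℝ), h u = r ∧ ‖v - u‖ ^ 2 / 2 + r < m + 1 / ((k : ℝ) + 1) := by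
    intro k
    obtain ⟨t, ⟨u, r, hr, rfl⟩, hlt⟩ := exists_lt_of_csInf_lt hne
      (lt_add_of_pos_right m (by positivity : (0 : ℝ) < 1 / ((k : ℝ) + 1)))
    exact ⟨u, r, hr, hlt⟩
  choose u r hur hlt using hseq
  -- By the parallelogram identity the objective at the midpoint is at most the mean of the two
  -- values minus `‖u j - u k‖ ^ 2 / 8`, yet it is at least `m`.
  have hdist : ∀ j k N : ℕ, N ≤ j → N ≤ k → ‖u j - u k‖ ^ 2 ≤ 8 * (1 / ((N : ℝ) + 1)) := by
    intro j k N hj hk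
    have h1 := hh.le_coe_of_eq_coe (hur j) (hur k) (a := 1 / 2) (b := 1 / 2)
      (by norm_num) (by norm_num) (by norm_num)
    obtain h2 | ⟨s, hs⟩ := hh.eq_top_or_coe ((1 / 2 : ℝ) • u j + (1 / 2 : ℝ) • u k)
    · rw [h2] at h1
      exact absurd (top_le_iff.1 h1) (EReal.coe_ne_top _)
    · rw [hs] at h1
      have h3 : s ≤ 1 / 2 * r j + 1 / 2 * r k := by exact_mod_cast h1
      have h4 := hmle _ s hs
      rw [norm_sub_midpoint_sq] at h4
      have h5 : 1 / ((j : ℝ) + 1) ≤ 1 / ((N : ℝ) + 1) := by gcongr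
      have h6 : 1 / ((k : ℝ) + 1) ≤ 1 / ((N : ℝ) + 1) := by gcongr
      have := hlt j
      have := hlt k
      linarith
  have hcauchy : CauchySeq u := by
    rw [Metric.cauchySeq_iff]
    intro ε hε
    obtain ⟨N, hN⟩ := exists_nat_one_div_lt (by positivity : (0 : ℝ) < ε ^ 2 / 8)
    refine ⟨N, fun j hj k hk => ?_⟩
    rw [dist_eq_norm]
    have := hdist j k N hj hk
    exact lt_of_pow_lt_pow_left₀ 2 hε.le (by linarith)
  obtain ⟨p, hp⟩ := cauchySeq_tendsto_of_complete hcauchy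
  have hhp : h p ≤ ((m - ‖v - p‖ ^ 2 / 2 : ℝ) : EReal) := by
    refine le_of_forall_lt fun y hy => ?_
    obtain ⟨z, hyz, hz⟩ := EReal.lt_iff_exists_real_btwn.1 hy
    refine hyz.trans_le ?_
    have h1 : ∀ᶠ k : ℕ in atTop, z ≤ m + 1 / ((k : ℝ) + 1) - ‖v - u k‖ ^ 2 / 2 := by
      filter_upwards [hp.eventually (hh.lsc p z hz)] with k hk
      rw [hur k] at hk
      have h2 : z < r k := by exact_mod_cast hk
      have := hlt k
      linarith
    have h2 : Tendsto (fun k : ℕ => m + 1 / ((k : ℝ) + 1) - ‖v - u k‖ ^ 2 / 2) atTop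
        (𝓝 (m + 0 - ‖v - p‖ ^ 2 / 2)) :=
      (tendsto_const_nhds.add tendsto_one_div_add_atTop_nhds_zero_nat).sub
        (((tendsto_const_nhds.sub hp).norm.pow 2).div_const 2)
    have h3 := ge_of_tendsto h2 h1
    rw [add_zero] at h3
    exact_mod_cast h3
  refine ⟨p, fun w _ => ?_⟩
  change proxObjective h v p ≤ proxObjective h v w
  obtain h1 | ⟨s, hs⟩ := hh.eq_top_or_coe w
  · rw [proxObjective, proxObjective, h1, EReal.coe_add_top]; exact le_top
  obtain h1 | ⟨t, ht⟩ := hh.eq_top_or_coe p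
  · rw [h1] at hhp
    exact absurd (top_le_iff.1 hhp) (EReal.coe_ne_top _)
  rw [proxObjective_of_eq_coe hs, proxObjective_of_eq_coe ht]
  rw [ht] at hhp
  have h2 : t ≤ m - ‖v - p‖ ^ 2 / 2 := by exact_mod_cast hhp
  have := hmle w s hs
  exact_mod_cast (by linarith : ‖v - p‖ ^ 2 / 2 + t ≤ ‖v - w‖ ^ 2 / 2 + s)

/-- `q` is a subgradient of `h` at `p`, a point where `h` is finite. -/
def IsSubgradient (h : E → EReal) (p q : E) : Prop :=
  ∃ r : ℝ, h p = r ∧ ∀ u, ((r + ⟪q, u - p⟫_ℝ : ℝ) : EReal) ≤ h u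

theorem IsSubgradient.monotone {h : E → EReal} {p q p' q' : E} (H : IsSubgradient h p q)
    (H' : IsSubgradient h p' q') : 0 ≤ ⟪q - q', p - p'⟫_ℝ := by
  obtain ⟨r, hr, hle⟩ := H
  obtain ⟨r', hr', hle'⟩ := H'
  have h1 := hle p'
  have h2 := hle' p
  rw [hr'] at h1
  rw [hr] at h2
  have h1 : r + ⟪q, p' - p⟫_ℝ ≤ r' := by exact_mod_cast h1
  have h2 : r' + ⟪q', p - p'⟫_ℝ ≤ r := by exact_mod_cast h2
  rw [← neg_sub p p', inner_neg_right] at h1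
  rw [inner_sub_left]
  linarith

theorem IsProperConvexLSC.isSubgradient_of_isMinOn {h : E → EReal} (hh : IsProperConvexLSC h)
    {v p : E} (hp : IsMinOn (proxObjective h v) Set.univ p) : IsSubgradient h p (v - p) := by
  have hp' : ∀ u, proxObjective h v p ≤ proxObjective h v u := fun u => hp (Set.mem_univ u)
  obtain ⟨r, hr⟩ : ∃ r : ℝ, h p = r := by
    obtain h1 | h1 := hh.eq_top_or_coe p
    · obtain ⟨u₀, r₀, hu₀⟩ := hh.exists_coe
      have h2 := hp' u₀
      rw [proxObjective_of_eq_coe hu₀, proxObjective, h1, EReal.coe_add_top] at h2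
      exact absurd (top_le_iff.1 h2) (EReal.coe_ne_top _)
    · exact h1
  refine ⟨r, hr, fun u => ?_⟩
  obtain hu | ⟨s, hs⟩ := hh.eq_top_or_coe u
  · rw [hu]; exact le_top
  rw [hs]
  suffices H : r + ⟪v - p, u - p⟫_ℝ ≤ s by exact_mod_cast H
  -- Minimality is tested at `t • u + (1 - t) • p` and divided by `t`; the quadratic remainder
  -- disappears as `t → 0`.
  have hkey : ∀ t : ℝ, 0 < t → t ≤ 1 → r + ⟪v - p, u - p⟫_ℝ ≤ s + t * (‖u - p‖ ^ 2 / 2) := by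
    intro t ht0 ht1
    have h1 := hh.le_coe_of_eq_coe hs hr ht0.le (sub_nonneg.2 ht1) (by ring)
    obtain h2 | ⟨q, hq⟩ := hh.eq_top_or_coe (t • u + (1 - t) • p)
    · rw [h2] at h1
      exact absurd (top_le_iff.1 h1) (EReal.coe_ne_top _)
    rw [hq] at h1
    have h3 : q ≤ t * s + (1 - t) * r := by exact_mod_cast h1
    have h4 := hp' (t • u + (1 - t) • p)
    rw [proxObjective_of_eq_coe hr, proxObjective_of_eq_coe hq] at h4
    have h5 : ‖v - p‖ ^ 2 / 2 + r ≤ ‖v - (t • u + (1 - t) • p)‖ ^ 2 / 2 + q := by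
      exact_mod_cast h4
    have h6 : v - (t • u + (1 - t) • p) = (v - p) - t • (u - p) := by module
    rw [h6, norm_sub_sq_real (v - p), inner_smul_right, norm_smul, mul_pow,
      Real.norm_of_nonneg ht0.le] at h5
    refine le_of_mul_le_mul_left ?_ ht0
    nlinarith
  have hlim : Tendsto (fun t : ℝ => s + t * (‖u - p‖ ^ 2 / 2)) (𝓝[>] 0)
      (𝓝 (s + 0 * (‖u - p‖ ^ 2 / 2))) :=
    ((continuous_const.add (continuous_id.mul continuous_const)).tendsto 0).mono_left
      nhdsWithin_le_nhds
  rw [zero_mul, add_zero] at hlim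
  refine ge_of_tendsto hlim ?_
  filter_upwards [Ioc_mem_nhdsGT (zero_lt_one (α := ℝ))] with t ht
  exact hkey t ht.1 ht.2

theorem IsProperConvexLSC.isSubgradient_prox [CompleteSpace E] {h : E → EReal}
    (hh : IsProperConvexLSC h) (v : E) : IsSubgradient h (prox h v) (v - prox h v) := by
  apply hh.isSubgradient_of_isMinOn
  rw [prox, dif_pos (hh.exists_isMinOn_proxObjective v)]
  exact (hh.exists_isMinOn_proxObjective v).choose_spec

theorem IsProperConvexLSC.isSubgradient_prox_scale [CompleteSpace E] {h : E → EReal}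
    (hh : IsProperConvexLSC h) {c : ℝ} (hc : 0 < c) (v : E) :
    IsSubgradient h (prox (SPDHG.scale c h) v) (c⁻¹ • (v - prox (SPDHG.scale c h) v)) := by
  obtain ⟨r, hr, hle⟩ := (hh.scale hc).isSubgradient_prox v
  set p := prox (SPDHG.scale c h) v
  obtain h1 | ⟨s, hs⟩ := hh.eq_top_or_coe p
  · rw [SPDHG.scale, h1, EReal.coe_mul_top_of_pos hc] at hr
    exact absurd hr.symm (EReal.coe_ne_top _)
  refine ⟨s, hs, fun u => ?_⟩
  obtain hu | ⟨t, ht⟩ := hh.eq_top_or_coe u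
  · rw [hu]; exact le_top
  have h2 := hle u
  rw [SPDHG.scale, hs] at hr
  rw [SPDHG.scale, ht] at h2
  have hr : c * s = r := by exact_mod_cast hr
  have h2 : r + ⟪v - p, u - p⟫_ℝ ≤ c * t := by exact_mod_cast h2
  rw [ht, inner_smul_left]
  have : s + c⁻¹ * ⟪v - p, u - p⟫_ℝ ≤ t := by
    refine le_of_mul_le_mul_left ?_ hc
    rw [mul_add, hr, mul_inv_cancel_left₀ hc.ne']
    exact h2
  exact_mod_cast this

theorem IsProperConvexLSC.conjugate [CompleteSpace E] {f : E → EReal} (hf : IsProperConvexLSC f) :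
    IsProperConvexLSC (conjugate f) where
  ne_bot y := by
    obtain ⟨u, r, hr⟩ := hf.exists_coe
    have h1 : ((⟪u, y⟫_ℝ : ℝ) : EReal) - f u ≤ SPDHG.conjugate f y :=
      le_iSup (fun x => ((⟪x, y⟫_ℝ : ℝ) : EReal) - f x) u
    rw [hr, ← EReal.coe_sub] at h1
    intro h2
    rw [h2] at h1
    exact EReal.coe_ne_bot _ (le_bot_iff.1 h1)
  proper := by
    obtain ⟨r, hr, hle⟩ := hf.isSubgradient_prox 0
    set p := prox f 0
    -- A subgradient of `f` is a point where the conjugate is finite, and `0 - p` is a subgradient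
    -- at `p = prox f 0`.
    refine ⟨0 - p, ne_top_of_le_ne_top (EReal.coe_ne_top (⟪0 - p, p⟫_ℝ - r)) ?_⟩
    refine iSup_le fun u => ?_
    obtain hu | ⟨s, hs⟩ := hf.eq_top_or_coe u
    · rw [hu, EReal.sub_top]; exact bot_le
    have h1 := hle u
    rw [hs] at h1 ⊢
    have h1 : r + ⟪0 - p, u - p⟫_ℝ ≤ s := by exact_mod_cast h1
    rw [inner_sub_right] at h1
    rw [real_inner_comm]
    exact_mod_cast (by linarith : ⟪0 - p, u⟫_ℝ - s ≤ ⟪0 - p, p⟫_ℝ - r)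
  convex x y a b ha hb hab := by
    refine iSup_le fun u => ?_
    obtain hu | ⟨s, hs⟩ := hf.eq_top_or_coe u
    · rw [hu, EReal.sub_top]; exact bot_le
    have h1 : ∀ y, ((⟪u, y⟫_ℝ - s : ℝ) : EReal) ≤ SPDHG.conjugate f y := fun y => by
      have := le_iSup (fun x => ((⟪x, y⟫_ℝ : ℝ) : EReal) - f x) u
      rwa [hs, ← EReal.coe_sub] at this
    have h2 := add_le_add
      (mul_le_mul_of_nonneg_left (h1 x) (by exact_mod_cast ha : (0 : EReal) ≤ (a : EReal)))
      (mul_le_mul_of_nonneg_left (h1 y) (by exact_mod_cast hb : (0 : EReal) ≤ (b : EReal)))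
    refine le_trans (le_of_eq ?_) h2
    rw [hs, inner_add_right, inner_smul_right, inner_smul_right]
    have : a * ⟪u, x⟫_ℝ + b * ⟪u, y⟫_ℝ - s = a * (⟪u, x⟫_ℝ - s) + b * (⟪u, y⟫_ℝ - s) := by
      linear_combination s * hab
    exact_mod_cast this
  lsc := by
    refine lowerSemicontinuous_iSup fun u => Continuous.lowerSemicontinuous ?_
    obtain hu | ⟨s, hs⟩ := hf.eq_top_or_coe u
    · simp only [hu, EReal.sub_top]; exact continuous_const
    · simp only [hs, ← EReal.coe_sub]
      exact continuous_coe_real_ereal.comp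
        ((continuous_const.inner continuous_id).sub continuous_const)

end ConvexAnalysis

/-! ### Saddle points as solutions of subgradient inclusions -/

section SaddlePoints

variable {n : ℕ} {X : Type*} [NormedAddCommGroup X] [InnerProductSpace ℝ X] [CompleteSpace X]
  {Y : Fin n → Type*} [∀ i, NormedAddCommGroup (Y i)] [∀ i, InnerProductSpace ℝ (Y i)]
  [∀ i, CompleteSpace (Y i)]
  {A : ∀ i, X →L[ℝ] Y i} {f : ∀ i, Y i → EReal} {g : X → EReal}

/-- The adjoint `A^* y = ∑ i, A_i^* y_i`. -/
noncomputable def adjointSum (A : ∀ i, X →L[ℝ] Y i) (y : PiLp 2 Y) : X :=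
  ∑ i, ContinuousLinearMap.adjoint (A i) (y i)

theorem inner_adjointSum (x : X) (y : PiLp 2 Y) :
    ⟪x, adjointSum A y⟫_ℝ = ∑ i, ⟪A i x, y i⟫_ℝ := by
  simp [adjointSum, inner_sum, ContinuousLinearMap.adjoint_inner_right]

theorem coe_sum_ereal {ι : Type*} (s : Finset ι) (c : ι → ℝ) :
    ((∑ i ∈ s, c i : ℝ) : EReal) = ∑ i ∈ s, (c i : EReal) := by
  classical
  induction s using Finset.induction_on with
  | empty => simp
  | insert i s hi ih => rw [Finset.sum_insert hi, Finset.sum_insert hi, EReal.coe_add, ih]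

theorem sum_ereal_eq_bot {ι : Type*} [DecidableEq ι] {s : Finset ι} {c : ι → EReal} {i : ι}
    (hi : i ∈ s) (hc : c i = ⊥) : ∑ j ∈ s, c j = ⊥ := by
  rw [← Finset.add_sum_erase s c hi, hc, EReal.bot_add]

omit [CompleteSpace X] [∀ i, CompleteSpace (Y i)] in
theorem lagrangian_of_eq_coe {x : X} {y : PiLp 2 Y} {r : ℝ} {s : Fin n → ℝ} (hr : g x = r)
    (hs : ∀ i, conjugate (f i) (y i) = s i) :
    lagrangian A f g x y = ((∑ i, (⟪A i x, y i⟫_ℝ - s i) + r : ℝ) : EReal) := by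
  rw [lagrangian, hr, EReal.coe_add, coe_sum_ereal]
  simp only [hs, EReal.coe_sub]

omit [CompleteSpace X] [∀ i, CompleteSpace (Y i)] in
theorem lagrangian_of_eq_top {x : X} {y : PiLp 2 Y} {s : Fin n → ℝ} (hr : g x = ⊤)
    (hs : ∀ i, conjugate (f i) (y i) = s i) : lagrangian A f g x y = ⊤ := by
  rw [lagrangian, hr]
  simp only [hs, ← EReal.coe_sub, ← coe_sum_ereal, EReal.coe_add_top]

omit [CompleteSpace X] [∀ i, CompleteSpace (Y i)] in
-- This holds even where `g x = ⊤`, since `⊥ + ⊤ = ⊥` in `EReal`.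
theorem lagrangian_of_conjugate_eq_top {x : X} {y : PiLp 2 Y} {i : Fin n}
    (hi : conjugate (f i) (y i) = ⊤) : lagrangian A f g x y = ⊥ := by
  rw [lagrangian, sum_ereal_eq_bot (Finset.mem_univ i) (by rw [hi, EReal.sub_top]), EReal.bot_add]

/-- The saddle inequality separates: varying `x` alone tests `g`, and varying a single `y i` tests
one conjugate. Comparison with a point where all functionals are finite first excludes infinite
values at the saddle point. -/
theorem isSaddlePoint_iff (hg : IsProperConvexLSC g) (hf : ∀ i, IsProperConvexLSC (f i))
    {w : X × PiLp 2 Y} :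
    IsSaddlePoint A f g w ↔ IsSubgradient g w.1 (-adjointSum A w.2) ∧
      ∀ i, IsSubgradient (conjugate (f i)) (w.2 i) (A i w.1) := by
  obtain ⟨x, y⟩ := w
  have hf' : ∀ i, IsProperConvexLSC (conjugate (f i)) := fun i => (hf i).conjugate
  constructor
  · intro h
    have hle : ∀ x' y', lagrangian A f g x y' ≤ lagrangian A f g x' y :=
      fun x' y' => h x' (Set.mem_univ _) y' (Set.mem_univ _)
    obtain ⟨x₀, r₀, hx₀⟩ := hg.exists_coe
    choose y₀ s₀ hy₀ using fun i => (hf' i).exists_coe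
    have hy₀' : ∀ i, conjugate (f i) ((WithLp.toLp 2 y₀ : PiLp 2 Y) i) = s₀ i := hy₀
    have hy : ∀ i, ∃ s : ℝ, conjugate (f i) (y i) = s := by
      intro i
      refine ((hf' i).eq_top_or_coe (y i)).resolve_left fun hi => ?_
      have h1 := hle x₀ (WithLp.toLp 2 y₀)
      rw [lagrangian_of_conjugate_eq_top hi] at h1
      obtain hx | ⟨r, hr⟩ := hg.eq_top_or_coe x
      · rw [lagrangian_of_eq_top hx hy₀'] at h1
        exact absurd h1 (by simp)
      · rw [lagrangian_of_eq_coe hr hy₀'] at h1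
        exact EReal.coe_ne_bot _ (le_bot_iff.1 h1)
    choose s hs using hy
    obtain ⟨r, hr⟩ : ∃ r : ℝ, g x = r := by
      refine (hg.eq_top_or_coe x).resolve_left fun hx => ?_
      have h1 := hle x₀ (WithLp.toLp 2 y₀)
      rw [lagrangian_of_eq_top hx hy₀', lagrangian_of_eq_coe hx₀ hs] at h1
      exact EReal.coe_ne_top _ (top_le_iff.1 h1)
    refine ⟨⟨r, hr, fun u => ?_⟩, fun i => ⟨s i, hs i, fun v => ?_⟩⟩
    · obtain hu | ⟨t, ht⟩ := hg.eq_top_or_coe u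
      · rw [hu]; exact le_top
      have h1 := hle u y
      rw [lagrangian_of_eq_coe hr hs, lagrangian_of_eq_coe ht hs] at h1
      have h1 : ∑ i, (⟪A i x, y i⟫_ℝ - s i) + r ≤ ∑ i, (⟪A i u, y i⟫_ℝ - s i) + t := by
        exact_mod_cast h1
      rw [Finset.sum_sub_distrib, Finset.sum_sub_distrib, ← inner_adjointSum,
        ← inner_adjointSum] at h1
      rw [ht, inner_neg_left, real_inner_comm, inner_sub_left]
      exact_mod_cast (by linarith :
        r + -(⟪u, adjointSum A y⟫_ℝ - ⟪x, adjointSum A y⟫_ℝ) ≤ t)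
    · obtain hv | ⟨t, ht⟩ := (hf' i).eq_top_or_coe v
      · rw [hv]; exact le_top
      have hs' : ∀ j, conjugate (f j)
          ((WithLp.toLp 2 (Function.update (fun j => y j) i v) : PiLp 2 Y) j)
          = Function.update s i t j := by
        intro j
        by_cases hj : j = i
        · subst hj; simpa using ht
        · simpa [Function.update_of_ne hj] using hs j
      have h1 := hle x (WithLp.toLp 2 (Function.update (fun j => y j) i v))
      rw [lagrangian_of_eq_coe hr hs, lagrangian_of_eq_coe hr hs', EReal.coe_le_coe_iff,
        add_le_add_iff_right, ← Finset.add_sum_erase _ _ (Finset.mem_univ i),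
        ← Finset.add_sum_erase _ _ (Finset.mem_univ i)] at h1
      rw [Finset.sum_congr rfl (g := fun j => ⟪A j x, y j⟫_ℝ - s j) (fun j hj => by
        simp [Function.update_of_ne (Finset.ne_of_mem_erase hj)])] at h1
      simp only [Function.update_self, add_le_add_iff_right] at h1
      rw [ht, inner_sub_right]
      exact_mod_cast (by linarith : s i + (⟪A i x, v⟫_ℝ - ⟪A i x, y i⟫_ℝ) ≤ t)
  · rintro ⟨⟨r, hr, hgle⟩, hF⟩
    choose s hs hfle using hF
    simp only at hr hs hgle hfle
    intro x' _ y' _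
    change lagrangian A f g x y' ≤ lagrangian A f g x' y
    by_cases hy' : ∃ i, conjugate (f i) (y' i) = ⊤
    · obtain ⟨i, hi⟩ := hy'
      rw [lagrangian_of_conjugate_eq_top hi]; exact bot_le
    push Not at hy'
    choose s' hs' using fun i => ((hf' i).eq_top_or_coe (y' i)).resolve_left (hy' i)
    obtain hx' | ⟨r', hr'⟩ := hg.eq_top_or_coe x'
    · rw [lagrangian_of_eq_top hx' hs]; exact le_top
    rw [lagrangian_of_eq_coe hr hs', lagrangian_of_eq_coe hr' hs, EReal.coe_le_coe_iff]
    have h1 := hgle x'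
    rw [hr', EReal.coe_le_coe_iff, inner_neg_left, real_inner_comm, inner_sub_left,
      inner_adjointSum, inner_adjointSum] at h1
    have h2 : ∑ i, (⟪A i x, y' i⟫_ℝ - s' i) ≤ ∑ i, (⟪A i x, y i⟫_ℝ - s i) := by
      refine Finset.sum_le_sum fun i _ => ?_
      have := hfle i (y' i)
      rw [hs', EReal.coe_le_coe_iff, inner_sub_right] at this
      linarith
    rw [Finset.sum_sub_distrib, Finset.sum_sub_distrib] at h2 ⊢
    linarith

end SaddlePoints

/-! ### Weak convergence, Opial's lemma, measurability of weak limits -/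

section WeakConvergence

theorem weakTendsto_iff {E : Type*} [NormedAddCommGroup E] [NormedSpace ℝ E] {v : ℕ → E} {v' : E} :
    WeakTendsto v v' ↔ ∀ φ : E →L[ℝ] ℝ, Tendsto (fun k => φ (v k)) atTop (𝓝 (φ v')) := by
  refine WeakBilin.tendsto_iff_forall_eval_tendsto (B := (topDualPairing ℝ E).flip) ?_
  intro x y hxy
  by_contra hne
  obtain ⟨φ, -, hφ⟩ := exists_dual_vector ℝ (x - y) (norm_ne_zero_iff.2 (sub_ne_zero.2 hne))
  have h1 : φ x = φ y := LinearMap.congr_fun hxy φ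
  rw [map_sub, h1, sub_self] at hφ
  exact hne (sub_eq_zero.1 (norm_eq_zero.1 (by simpa using hφ.symm)))

theorem WeakTendsto.clm {E F : Type*} [NormedAddCommGroup E] [NormedSpace ℝ E]
    [NormedAddCommGroup F] [NormedSpace ℝ F] {v : ℕ → E} {v' : E} (h : WeakTendsto v v')
    (T : E →L[ℝ] F) : WeakTendsto (fun k => T (v k)) (T v') :=
  weakTendsto_iff.2 fun φ => weakTendsto_iff.1 h (φ ∘L T)

section Normed

variable {E F : Type*} [NormedAddCommGroup E] [NormedSpace ℝ E]
  [NormedAddCommGroup F] [NormedSpace ℝ F]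

theorem weakTendsto_of_tendsto {v : ℕ → E} {v' : E} (h : Tendsto v atTop (𝓝 v')) :
    WeakTendsto v v' :=
  weakTendsto_iff.2 fun φ => (φ.continuous.tendsto v').comp h

theorem WeakTendsto.add {v w : ℕ → E} {v' w' : E} (hv : WeakTendsto v v')
    (hw : WeakTendsto w w') : WeakTendsto (fun k => v k + w k) (v' + w') := by
  refine weakTendsto_iff.2 fun φ => ?_
  simpa using (weakTendsto_iff.1 hv φ).add (weakTendsto_iff.1 hw φ)

theorem WeakTendsto.sub {v w : ℕ → E} {v' w' : E} (hv : WeakTendsto v v')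
    (hw : WeakTendsto w w') : WeakTendsto (fun k => v k - w k) (v' - w') := by
  refine weakTendsto_iff.2 fun φ => ?_
  simpa using (weakTendsto_iff.1 hv φ).sub (weakTendsto_iff.1 hw φ)

theorem WeakTendsto.add_tendsto_zero {v w : ℕ → E} {v' : E} (hv : WeakTendsto v v')
    (hw : Tendsto w atTop (𝓝 0)) : WeakTendsto (fun k => v k + w k) v' := by
  simpa using hv.add (weakTendsto_of_tendsto hw)

theorem WeakTendsto.comp {v : ℕ → E} {v' : E} (hv : WeakTendsto v v') {φ : ℕ → ℕ}
    (hφ : Tendsto φ atTop atTop) : WeakTendsto (fun k => v (φ k)) v' :=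
  Tendsto.comp (g := fun k => toWeakSpace ℝ E (v k)) hv hφ

theorem WeakTendsto.prodMk {v : ℕ → E} {w : ℕ → F} {v' : E} {w' : F} (hv : WeakTendsto v v')
    (hw : WeakTendsto w w') : WeakTendsto (fun k => (v k, w k)) (v', w') := by
  have := (hv.clm (ContinuousLinearMap.inl ℝ E F)).add (hw.clm (ContinuousLinearMap.inr ℝ E F))
  simpa using this

theorem WeakTendsto.unique {v : ℕ → E} {v' v'' : E} (h : WeakTendsto v v')
    (h' : WeakTendsto v v'') : v' = v'' := by
  by_contra hne
  obtain ⟨φ, -, hφ⟩ := exists_dual_vector ℝ (v' - v'') (norm_ne_zero_iff.2 (sub_ne_zero.2 hne))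
  rw [map_sub, tendsto_nhds_unique (weakTendsto_iff.1 h φ) (weakTendsto_iff.1 h' φ),
    sub_self] at hφ
  exact hne (sub_eq_zero.1 (norm_eq_zero.1 (by simpa using hφ.symm)))

/-- Opial's lemma, for the quadratic form of a positive definite bilinear form: a sequence whose
distances to the points of a dense subset of `F` converge, and whose subsequences have weak cluster
points in `F`, converges weakly to a point of `F`. -/
theorem exists_weakTendsto_of_tendsto_bilin {B : E →L[ℝ] E →L[ℝ] ℝ}
    (hB : ∀ e, B e e = 0 → e = 0) {F D : Set E} (hDF : F ⊆ closure D) {v : ℕ → E}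
    (hconv : ∀ d ∈ D, ∃ l, Tendsto (fun k => B (v k - d) (v k - d)) atTop (𝓝 l))
    (hcpt : ∀ φ : ℕ → ℕ, Tendsto φ atTop atTop →
      ∃ ψ : ℕ → ℕ, Tendsto ψ atTop atTop ∧ ∃ u ∈ F, WeakTendsto (fun k => v (φ (ψ k))) u) :
    ∃ u ∈ F, WeakTendsto v u := by
  -- The terms quadratic in `v k` cancel in the difference of the forms for `d` and `d'`, leaving a
  -- linear functional of `v k` plus a constant.
  have hsymm : ∀ d ∈ D, ∀ d' ∈ D,
      ∃ l, Tendsto (fun k => (B.flip (d' - d) + B (d' - d)) (v k)) atTop (𝓝 l) := by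
    intro d hd d' hd'
    obtain ⟨l, hl⟩ := hconv d hd
    obtain ⟨l', hl'⟩ := hconv d' hd'
    refine ⟨l - l' - (B d d - B d' d'), ((hl.sub hl').sub_const _).congr fun k => ?_⟩
    simp only [add_apply, ContinuousLinearMap.flip_apply, map_sub,
      sub_apply]
    ring
  have huniq : ∀ u ∈ F, ∀ u' ∈ F, ∀ φ φ' : ℕ → ℕ, Tendsto φ atTop atTop →
      Tendsto φ' atTop atTop → WeakTendsto (fun k => v (φ k)) u →
      WeakTendsto (fun k => v (φ' k)) u' → u = u' := by
    intro u hu u' hu' φ φ' hφ hφ' hw hw'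
    have h1 : ∀ p ∈ D ×ˢ D,
        (B.flip (p.2 - p.1) + B (p.2 - p.1)) u = (B.flip (p.2 - p.1) + B (p.2 - p.1)) u' := by
      rintro ⟨d, d'⟩ ⟨hd, hd'⟩
      obtain ⟨l, hl⟩ := hsymm d hd d' hd'
      rw [tendsto_nhds_unique (weakTendsto_iff.1 hw _) (hl.comp hφ),
        tendsto_nhds_unique (weakTendsto_iff.1 hw' _) (hl.comp hφ')]
    have hc : ∀ z, Continuous fun p : E × E => (B.flip (p.2 - p.1) + B (p.2 - p.1)) z := by
      intro z
      simp only [add_apply]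
      fun_prop
    have h2 : Set.EqOn _ _ (closure (D ×ˢ D)) := Set.EqOn.closure h1 (hc u) (hc u')
    -- For the pair `(u', u)` the functional takes equal values at `u` and `u'`; the difference of
    -- these values is `2 * B (u - u') (u - u')`. Symmetry of `B` is not needed.
    have h3 := h2 (x := (u', u)) (by rw [closure_prod_eq]; exact ⟨hDF hu', hDF hu⟩)
    simp only [add_apply, ContinuousLinearMap.flip_apply] at h3
    refine sub_eq_zero.1 (hB _ ?_)
    have h4 : B (u - u') (u - u') = B u (u - u') - B u' (u - u') := by
      rw [map_sub B, sub_apply]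
    have h5 : B (u - u') (u - u') = B (u - u') u - B (u - u') u' := by rw [map_sub]
    linarith
  obtain ⟨ψ, hψ, u, hu, hw⟩ := hcpt id tendsto_id
  refine ⟨u, hu, tendsto_of_subseq_tendsto fun ns hns => ?_⟩
  obtain ⟨ψ', hψ', u', hu', hw'⟩ := hcpt ns hns
  rw [huniq u hu u' hu' (fun k => id (ψ k)) (fun k => ns (ψ' k)) hψ (hns.comp hψ') hw hw']
  exact ⟨ψ', hw'⟩

end Normed

section Hilbert

variable {E : Type*} [NormedAddCommGroup E] [InnerProductSpace ℝ E] [CompleteSpace E]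
  [TopologicalSpace.SeparableSpace E]

omit [TopologicalSpace.SeparableSpace E] in
theorem weakTendsto_iff_inner {v : ℕ → E} {v' : E} :
    WeakTendsto v v' ↔ ∀ u : E, Tendsto (fun k => ⟪u, v k⟫_ℝ) atTop (𝓝 ⟪u, v'⟫_ℝ) := by
  rw [weakTendsto_iff]
  refine ⟨fun h u => h (innerSL ℝ u), fun h φ => ?_⟩
  have := h ((InnerProductSpace.toDual ℝ E).symm φ)
  simpa using this

/-- Sequential Banach–Alaoglu in the dual of a separable space, transported by the Riesz
isomorphism. -/
theorem exists_weakTendsto_subseq {v : ℕ → E} {R : ℝ} (hv : ∀ k, ‖v k‖ ≤ R) :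
    ∃ (v' : E) (φ : ℕ → ℕ), StrictMono φ ∧ WeakTendsto (fun k => v (φ k)) v' := by
  have hc := WeakDual.isSeqCompact_closedBall ℝ E 0 R
  obtain ⟨a, -, φ, hφ, hlim⟩ := hc (x := fun k =>
    StrongDual.toWeakDual (InnerProductSpace.toDual ℝ E (v k))) (fun k => by
      simpa using hv k)
  refine ⟨(InnerProductSpace.toDual ℝ E).symm (WeakDual.toStrongDual a), φ, hφ,
    weakTendsto_iff_inner.2 fun u => ?_⟩
  have h1 := ((WeakDual.eval_continuous (𝕜 := ℝ) u).tendsto a).comp hlim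
  rw [real_inner_comm, InnerProductSpace.toDual_symm_apply]
  refine h1.congr fun k => ?_
  exact real_inner_comm _ _

/-- A weak limit of strongly measurable functions is strongly measurable. -/
theorem aestronglyMeasurable_of_weakTendsto {Ω : Type*} [MeasurableSpace Ω] {P : Measure Ω}
    {v : ℕ → Ω → E} {v' : Ω → E} (hv : ∀ k, AEStronglyMeasurable (v k) P)
    (hlim : ∀ᵐ ω ∂P, WeakTendsto (fun k => v k ω) (v' ω)) : AEStronglyMeasurable v' P := by
  have hinner : ∀ u : E, AEStronglyMeasurable (fun ω => ⟪u, v' ω⟫_ℝ) P := fun u =>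
    aestronglyMeasurable_of_tendsto_ae atTop (fun k => (hv k).const_inner)
      (hlim.mono fun ω hω => weakTendsto_iff_inner.1 hω u)
  -- Projections onto these finite-dimensional spaces are finite combinations of inner products,
  -- hence measurable, and they converge in norm to the identity.
  let U : ℕ → Submodule ℝ E := fun N =>
    Submodule.span ℝ (TopologicalSpace.denseSeq E '' Set.Iic N)
  have hfin : ∀ N, FiniteDimensional ℝ (U N) := fun N =>
    FiniteDimensional.span_of_finite ℝ ((Set.finite_Iic N).image _)
  have hmono : Monotone U := fun N M h =>
    Submodule.span_mono (Set.image_mono (Set.Iic_subset_Iic.2 h))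
  have hdense : ⊤ ≤ (⨆ N, U N).topologicalClosure := by
    rw [top_le_iff, ← Submodule.dense_iff_topologicalClosure_eq_top]
    refine (TopologicalSpace.denseRange_denseSeq E).mono ?_
    rintro _ ⟨N, rfl⟩
    exact (le_iSup U N) (Submodule.subset_span ⟨N, Set.self_mem_Iic, rfl⟩)
  refine aestronglyMeasurable_of_tendsto_ae atTop
    (f := fun N ω => (U N).starProjection (v' ω)) (fun N => ?_)
    (Eventually.of_forall fun ω => Submodule.starProjection_tendsto_self U hmono (v' ω) hdense)
  have heq : ∀ x : E, (U N).starProjection x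
      = ∑ i, ⟪(stdOrthonormalBasis ℝ (U N) i : E), x⟫_ℝ • (stdOrthonormalBasis ℝ (U N) i : E) := by
    intro x
    rw [OrthonormalBasis.starProjection_eq_sum_rankOne (stdOrthonormalBasis ℝ (U N))]
    simp
  simp only [heq]
  exact Finset.aestronglyMeasurable_fun_sum _ fun i _ => (hinner _).smul_const _

end Hilbert

end WeakConvergence

/-! ### Random iterations and supermartingale convergence -/

section RandomIteration

variable {Ω : Type*} [mΩ : MeasurableSpace Ω] {P : Measure Ω} {ι : Type*} [MeasurableSpace ι]
  {S : ℕ → Ω → ι} {W : Type*} {T : ι → W → W} {z₀ : W} {Z : ℕ → Ω → W}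

/-- The filtration of the past: at time `k`, the variables `S j` with `j < k` are known. -/
def pastFiltration (hS : ∀ k, Measurable (S k)) : Filtration ℕ mΩ where
  seq k := ⨆ j ∈ Set.Iio k, MeasurableSpace.comap (S j) inferInstance
  mono' _ _ h := biSup_mono fun _ hj => lt_of_lt_of_le hj h
  le' _ := iSup₂_le fun j _ => (hS j).comap_le

omit mΩ [MeasurableSpace ι] in
-- The starting point is deterministic, so for finite `ι` only finitely many states occur at time
-- `k`. Measurability and integrability then hold for any `T` and any function of the state.
theorem exists_eq_history (h0 : ∀ ω, Z 0 ω = z₀) (hZ : ∀ k ω, Z (k + 1) ω = T (S k ω) (Z k ω))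
    (k : ℕ) : ∃ G : (Fin k → ι) → W, ∀ ω, Z k ω = G fun j => S j ω := by
  induction k with
  | zero => exact ⟨fun _ => z₀, h0⟩
  | succ k ih =>
    obtain ⟨G, hG⟩ := ih
    exact ⟨fun h => T (h (Fin.last k)) (G fun j => h j.castSucc), fun ω => by simp [hZ, hG]⟩

theorem measurable_history (hS : ∀ k, Measurable (S k)) (k : ℕ) :
    Measurable[pastFiltration hS k] fun ω (j : Fin k) => S j ω := by
  refine @measurable_pi_lambda _ _ _ (pastFiltration hS k) _ _ fun j => ?_
  exact (comap_measurable (S j)).mono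
    (le_biSup (fun j => MeasurableSpace.comap (S j) inferInstance) (Set.mem_Iio.2 j.2)) le_rfl

variable [Finite ι] [DiscreteMeasurableSpace ι]

theorem stronglyMeasurable_comp_randomIteration (hS : ∀ k, Measurable (S k))
    (h0 : ∀ ω, Z 0 ω = z₀) (hZ : ∀ k ω, Z (k + 1) ω = T (S k ω) (Z k ω)) (k : ℕ)
    {F : Type*} [TopologicalSpace F] (φ : W → F) :
    StronglyMeasurable[pastFiltration hS k] fun ω => φ (Z k ω) := by
  obtain ⟨G, hG⟩ := exists_eq_history h0 hZ k
  simp only [hG]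
  exact (StronglyMeasurable.of_discrete (f := fun h => φ (G h))).comp_measurable
    (measurable_history hS k)

variable [IsProbabilityMeasure P]

theorem integrable_comp_randomIteration (hS : ∀ k, Measurable (S k))
    (h0 : ∀ ω, Z 0 ω = z₀) (hZ : ∀ k ω, Z (k + 1) ω = T (S k ω) (Z k ω)) (k : ℕ)
    (φ : W → ℝ) : Integrable (fun ω => φ (Z k ω)) P := by
  obtain ⟨G, hG⟩ := exists_eq_history h0 hZ k
  simp only [hG]
  exact (Integrable.of_finite (f := fun h => φ (G h))).comp_measurable
    ((measurable_history hS k).mono ((pastFiltration hS).le k) le_rfl)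

omit [Finite ι] [DiscreteMeasurableSpace ι] [IsProbabilityMeasure P] in
theorem indep_pastFiltration (hS : ∀ k, Measurable (S k)) (hindep : iIndepFun S P) (k : ℕ) :
    Indep (pastFiltration hS k) (MeasurableSpace.comap (S k) inferInstance) P := by
  have := indep_iSup_of_disjoint (fun j => (hS j).comap_le) hindep (S := Set.Iio k) (T := {k})
    (by simp)
  simpa [pastFiltration] using this

/-- This is the conditional expectation given the past, in integrated form: split by the value of `S
k`, which is independent of the past and distributed as `S 0`. -/
theorem setIntegral_step_randomIteration [Fintype ι] (hS : ∀ k, Measurable (S k))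
    (hindep : iIndepFun S P) (hident : ∀ k, IdentDistrib (S k) (S 0) P P)
    (h0 : ∀ ω, Z 0 ω = z₀) (hZ : ∀ k ω, Z (k + 1) ω = T (S k ω) (Z k ω)) (k : ℕ)
    (φ : W → ℝ) {B : Set Ω} (hB : MeasurableSet[pastFiltration hS k] B) :
    ∫ ω in B, φ (Z (k + 1) ω) ∂P
      = ∫ ω in B, ∑ s, P.real (S 0 ⁻¹' {s}) * φ (T s (Z k ω)) ∂P := by
  have hB' : MeasurableSet B := (pastFiltration hS).le k _ hB
  have hint : ∀ s, Integrable (fun ω => φ (T s (Z k ω))) P := fun s =>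
    integrable_comp_randomIteration hS h0 hZ k fun z => φ (T s z)
  have hSs : ∀ s, MeasurableSet (S k ⁻¹' {s}) := fun s => hS k (.of_discrete)
  have hsplit : ∀ ω, φ (Z (k + 1) ω)
      = ∑ s, (S k ⁻¹' {s}).indicator (fun ω => φ (T s (Z k ω))) ω := by
    intro ω
    rw [hZ, Finset.sum_eq_single (S k ω)]
    · rw [Set.indicator_of_mem (by simp)]
    · intro s _ hs
      exact Set.indicator_of_notMem (by simpa using hs.symm) _
    · simp
  simp only [hsplit]
  rw [integral_finsetSum _ fun s _ => ((hint s).indicator (hSs s)).integrableOn,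
    integral_finsetSum _ fun s _ => ((hint s).const_mul _).integrableOn]
  refine Finset.sum_congr rfl fun s _ => ?_
  have hind : IndepFun (B.indicator fun ω => φ (T s (Z k ω)))
      ((S k ⁻¹' {s}).indicator fun _ => (1 : ℝ)) P := by
    rw [IndepFun_iff_Indep]
    refine indep_of_indep_of_le_left (indep_of_indep_of_le_right
      (indep_pastFiltration hS hindep k) ?_) ?_
    · refine Measurable.comap_le ?_
      exact measurable_const.indicator ⟨{s}, .of_discrete, rfl⟩
    · refine Measurable.comap_le ?_
      exact ((stronglyMeasurable_comp_randomIteration hS h0 hZ k fun z =>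
        φ (T s z)).indicator hB).measurable
  have hprod := hind.integral_mul_eq_mul_integral
    ((hint s).indicator hB').aestronglyMeasurable
    (aestronglyMeasurable_const.indicator (hSs s))
  rw [integral_indicator hB', integral_indicator_const _ (hSs s)] at hprod
  rw [integral_const_mul, ← integral_indicator hB', Set.indicator_indicator]
  have hP : P.real (S k ⁻¹' {s}) = P.real (S 0 ⁻¹' {s}) := by
    simp only [Measure.real, (hident k).measure_mem_eq (MeasurableSet.of_discrete (s := {s}))]
  rw [← hP, mul_comm]
  simp only [smul_eq_mul, mul_one] at hprod
  rw [← hprod]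
  congr 1
  ext ω
  by_cases h1 : ω ∈ B <;> by_cases h2 : ω ∈ S k ⁻¹' {s} <;> simp [Set.indicator, h1, h2]

/-- Convergence of a random iteration `Z_{k+1} = T (S_k) Z_k` with independent and identically
distributed `S_k`, under a Lyapunov function `V` whose expected decrease is at least `D`. -/
theorem ae_tendsto_randomIteration [Fintype ι] (hS : ∀ k, Measurable (S k))
    (hindep : iIndepFun S P) (hident : ∀ k, IdentDistrib (S k) (S 0) P P)
    (h0 : ∀ ω, Z 0 ω = z₀) (hZ : ∀ k ω, Z (k + 1) ω = T (S k ω) (Z k ω))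
    {V D : W → ℝ} {I : W → Prop} (hI0 : I z₀) (hIT : ∀ s z, I z → I (T s z))
    (hV : ∀ z, I z → 0 ≤ V z) (hD : ∀ z, 0 ≤ D z)
    (hstep : ∀ z, I z → ∑ s, P.real (S 0 ⁻¹' {s}) * V (T s z) + D z ≤ V z) :
    ∀ᵐ ω ∂P, (∃ l, Tendsto (fun k => V (Z k ω)) atTop (𝓝 l)) ∧
      Tendsto (fun k => D (Z k ω)) atTop (𝓝 0) := by
  have hI : ∀ k ω, I (Z k ω) := by
    intro k ω
    induction k with
    | zero => rw [h0]; exact hI0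
    | succ k ih => rw [hZ]; exact hIT _ _ ih
  have hint := fun k φ => integrable_comp_randomIteration (P := P) hS h0 hZ k φ
  have hdec : ∀ k, ∀ B, MeasurableSet[pastFiltration hS k] B →
      ∫ ω in B, V (Z (k + 1) ω) ∂P + ∫ ω in B, D (Z k ω) ∂P ≤ ∫ ω in B, V (Z k ω) ∂P := by
    intro k B hB
    rw [setIntegral_step_randomIteration hS hindep hident h0 hZ k V hB, ← integral_add]
    · refine integral_mono ?_ (hint k V).integrableOn fun ω => hstep _ (hI k ω)
      exact (integrable_finsetSum _ fun s _ => ((hint k fun z => V (T s z)).const_mul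
        _).integrableOn).add (hint k D).integrableOn
    · exact integrable_finsetSum _ fun s _ => ((hint k fun z => V (T s z)).const_mul
        _).integrableOn
    · exact (hint k D).integrableOn
  have hsuper : Supermartingale (fun k ω => V (Z k ω)) (pastFiltration hS) P := by
    refine supermartingale_of_setIntegral_succ_le
      (fun k => stronglyMeasurable_comp_randomIteration hS h0 hZ k V) (fun k => hint k V)
      fun k B hB => ?_
    have h1 : 0 ≤ ∫ ω in B, D (Z k ω) ∂P := integral_nonneg fun ω => hD _
    linarith [hdec k B hB]
  have hdec' : ∀ k, ∫ ω, V (Z (k + 1) ω) ∂P + ∫ ω, D (Z k ω) ∂P ≤ ∫ ω, V (Z k ω) ∂P := by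
    intro k
    simpa using hdec k Set.univ MeasurableSet.univ
  have hsum : ∀ N, ∫ ω, V (Z N ω) ∂P + ∑ k ∈ Finset.range N, ∫ ω, D (Z k ω) ∂P ≤ V z₀ := by
    intro N
    induction N with
    | zero => simp [h0]
    | succ N ih => rw [Finset.sum_range_succ]; linarith [hdec' N]
  have hDint : ∀ k, 0 ≤ ∫ ω, D (Z k ω) ∂P := fun k => integral_nonneg fun ω => hD _
  have hVint : ∀ k, 0 ≤ ∫ ω, V (Z k ω) ∂P := fun k => integral_nonneg fun ω => hV _ (hI k ω)
  have hconv : ∀ᵐ ω ∂P, ∃ l, Tendsto (fun k => V (Z k ω)) atTop (𝓝 l) := by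
    -- As `V` is nonnegative along the iteration, its `L¹` norm is its expectation, at most `V z₀`;
    -- the negative is thus an `L¹`-bounded submartingale.
    have h1 := hsuper.neg.exists_ae_tendsto_of_bdd (R := (V z₀).toNNReal) fun k => by
      rw [eLpNorm_one_eq_lintegral_enorm, ← ofReal_integral_norm_eq_lintegral_enorm
        (f := (-fun k ω => V (Z k ω)) k) (hint k V).neg]
      refine ENNReal.ofReal_le_ofReal ?_
      have : ∀ ω, ‖(-fun k ω => V (Z k ω)) k ω‖ = V (Z k ω) := fun ω => by
        simp [abs_of_nonneg (hV _ (hI k ω))]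
      simp only [this]
      linarith [hsum k, Finset.sum_nonneg fun j (_ : j ∈ Finset.range k) => hDint j]
    filter_upwards [h1] with ω ⟨c, hc⟩
    exact ⟨-c, by simpa using hc.neg⟩
  -- The expected decreases sum to at most `V z₀`, so the series is almost surely finite and its
  -- terms tend to zero.
  have hDsum : ∀ᵐ ω ∂P, ∑' k, ENNReal.ofReal (D (Z k ω)) < ⊤ := by
    have hm : ∀ k, Measurable fun ω => ENNReal.ofReal (D (Z k ω)) := fun k =>
      (((stronglyMeasurable_comp_randomIteration hS h0 hZ k D).mono
        ((pastFiltration hS).le k)).measurable).ennreal_ofReal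
    refine ae_lt_top (Measurable.tsum hm) ?_
    rw [lintegral_tsum fun k => (hm k).aemeasurable]
    refine ne_top_of_le_ne_top (ENNReal.ofReal_ne_top (r := V z₀))
      (ENNReal.tsum_le_of_sum_range_le fun N => ?_)
    have h1 : ∀ k, ∫⁻ ω, ENNReal.ofReal (D (Z k ω)) ∂P = ENNReal.ofReal (∫ ω, D (Z k ω) ∂P) :=
      fun k => (ofReal_integral_eq_lintegral_ofReal (hint k D)
        (Eventually.of_forall fun ω => hD _)).symm
    simp only [h1]
    rw [← ENNReal.ofReal_sum_of_nonneg fun k _ => hDint k]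
    exact ENNReal.ofReal_le_ofReal (by linarith [hsum N, hVint N])
  filter_upwards [hconv, hDsum] with ω h1 h2
  refine ⟨h1, ?_⟩
  have h3 := (ENNReal.tendsto_toReal ENNReal.zero_ne_top).comp
    (ENNReal.tendsto_atTop_zero_of_tsum_ne_top h2.ne)
  rw [ENNReal.toReal_zero] at h3
  exact h3.congr fun k => ENNReal.toReal_ofReal (hD _)

end RandomIteration

/-! ### The step size operator and the extrapolation term -/

section StepSize

variable {n : ℕ} {X : Type*} [NormedAddCommGroup X] [InnerProductSpace ℝ X] [CompleteSpace X]
  {Y : Fin n → Type*} [∀ i, NormedAddCommGroup (Y i)] [∀ i, InnerProductSpace ℝ (Y i)]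
  [∀ i, CompleteSpace (Y i)]

/-- The extrapolation term `∑ i ∈ s, p_i⁻¹ A_i^* d_i`. -/
noncomputable def extrapolation (A : ∀ i, X →L[ℝ] Y i) (p : Fin n → ℝ) (d : ∀ i, Y i)
    (s : Finset (Fin n)) : X :=
  ∑ i ∈ s, (p i)⁻¹ • ContinuousLinearMap.adjoint (A i) (d i)

omit [CompleteSpace X] [∀ i, CompleteSpace (Y i)] in
theorem restrictedOp_apply (A : ∀ i, X →L[ℝ] Y i) (s : Finset (Fin n)) (x : X) (i : Fin n) :
    restrictedOp A s x i = if i ∈ s then A i x else 0 := by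
  simp only [restrictedOp, ContinuousLinearMap.comp_apply]
  change (ContinuousLinearMap.pi fun i => if i ∈ s then A i else 0) x i = _
  rw [ContinuousLinearMap.pi_apply]
  split_ifs <;> rfl

theorem adjoint_restrictedOp_apply (A : ∀ i, X →L[ℝ] Y i) (s : Finset (Fin n)) (y : PiLp 2 Y) :
    ContinuousLinearMap.adjoint (restrictedOp A s) y
      = ∑ i ∈ s, ContinuousLinearMap.adjoint (A i) (y i) := by
  refine ext_inner_left ℝ fun x => ?_
  rw [ContinuousLinearMap.adjoint_inner_right, PiLp.inner_apply, inner_sum]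
  simp only [restrictedOp_apply, ContinuousLinearMap.adjoint_inner_right]
  rw [← Finset.sum_subset (Finset.subset_univ s) fun i _ hi => by rw [if_neg hi, inner_zero_left]]
  exact Finset.sum_congr rfl fun i hi => by rw [if_pos hi]

variable {Ω : Type*} [MeasurableSpace Ω] {P : Measure Ω} [IsProbabilityMeasure P]

omit [CompleteSpace X] [∀ i, CompleteSpace (Y i)] in
theorem integral_comp_finset {F : Type*} [NormedAddCommGroup F] [NormedSpace ℝ F]
    [CompleteSpace F] {S : Ω → Finset (Fin n)} (hS : Measurable S) (φ : Finset (Fin n) → F) :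
    ∫ ω, φ (S ω) ∂P = ∑ s, P.real (S ⁻¹' {s}) • φ s := by
  have : IsProbabilityMeasure (P.map S) := Measure.isProbabilityMeasure_map hS.aemeasurable
  rw [← integral_map hS.aemeasurable (f := φ) (StronglyMeasurable.of_discrete).aestronglyMeasurable,
    integral_fintype Integrable.of_finite]
  refine Finset.sum_congr rfl fun s _ => ?_
  rw [map_measureReal_apply hS .of_discrete]

theorem sum_prob_eq_one {S : Ω → Finset (Fin n)} (hS : Measurable S) :
    ∑ s, P.real (S ⁻¹' {s}) = 1 := by
  have := integral_comp_finset (P := P) hS fun _ => (1 : ℝ)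
  simpa using this.symm

/-- With `u i` weighted by `(p i)⁻¹`, this makes the sampled sum an unbiased estimate of the full
sum. -/
theorem sum_prob_smul_sum {F : Type*} [AddCommGroup F] [Module ℝ F]
    {S : Ω → Finset (Fin n)} (hS : Measurable S) (u : Fin n → F) :
    ∑ s, P.real (S ⁻¹' {s}) • ∑ i ∈ s, u i = ∑ i, inclusionProb P S i • u i := by
  have h1 : ∀ i, inclusionProb P S i = ∑ s, P.real (S ⁻¹' {s}) * if i ∈ s then 1 else 0 := by
    intro i
    have h2 := integral_comp_finset (P := P) hS fun s => if i ∈ s then (1 : ℝ) else 0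
    simp only [smul_eq_mul] at h2
    have hm : MeasurableSet {ω | i ∈ S ω} := hS (.of_discrete (s := {s | i ∈ s}))
    rw [← h2, inclusionProb, ← integral_indicator_one hm]
    refine integral_congr_ae (Eventually.of_forall fun ω => ?_)
    simp [Set.indicator]
  simp only [h1, Finset.sum_smul]
  rw [Finset.sum_comm]
  refine Finset.sum_congr rfl fun s _ => ?_
  rw [Finset.smul_sum, ← Finset.sum_subset (Finset.subset_univ s) fun i _ hi => by
    rw [if_neg hi, mul_zero, zero_smul]]
  exact Finset.sum_congr rfl fun i hi => by rw [if_pos hi, mul_one]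

/-- The expected separable overapproximation given by the norm of the step size operator. -/
theorem sum_prob_mul_norm_extrapolation_sq_le {S : Ω → Finset (Fin n)} (hS : Measurable S)
    (A : ∀ i, X →L[ℝ] Y i) {τ : ℝ} (hτ : 0 < τ) {σ : Fin n → ℝ} (hσ : ∀ i, 0 < σ i)
    (d : ∀ i, Y i) :
    ∑ s, P.real (S ⁻¹' {s}) * (τ * ‖extrapolation A (inclusionProb P S) d s‖ ^ 2)
      ≤ ‖stepSizeOp P S A τ σ‖ * ∑ i, ‖d i‖ ^ 2 / σ i := by
  set p := inclusionProb P S with hp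
  set C : ∀ i, X →L[ℝ] Y i := fun i => (√τ * √(σ i)) • A i with hC
  set Q : PiLp 2 Y →L[ℝ] PiLp 2 Y := weightOp Y p with hQ
  -- The scaling is chosen so that `C_s^* Q u` is `√τ` times the extrapolation term; the expected
  -- square is then the quadratic form `⟪u, D u⟫`.
  set u : PiLp 2 Y := WithLp.toLp 2 fun i => (√(σ i))⁻¹ • d i with hu
  have hCQ : ∀ s, ContinuousLinearMap.adjoint (restrictedOp C s) (Q u)
      = √τ • extrapolation A p d s := by
    intro s
    rw [adjoint_restrictedOp_apply, extrapolation, Finset.smul_sum]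
    refine Finset.sum_congr rfl fun i _ => ?_
    have h1 : Q u i = (p i)⁻¹ • (√(σ i))⁻¹ • d i := rfl
    rw [h1, hC]
    simp only [map_smul, ContinuousLinearMap.adjoint.map_smulₛₗ]
    have h2 : √(σ i) ≠ 0 := (Real.sqrt_pos.2 (hσ i)).ne'
    simp [smul_smul]
    congr 1
    field_simp
  have hQself : ∀ a b : PiLp 2 Y, ⟪a, Q b⟫_ℝ = ⟪Q a, b⟫_ℝ := by
    intro a b
    rw [PiLp.inner_apply, PiLp.inner_apply]
    refine Finset.sum_congr rfl fun i _ => ?_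
    have h1 : ∀ c : PiLp 2 Y, Q c i = (p i)⁻¹ • c i := fun c => rfl
    rw [h1, h1, inner_smul_right, real_inner_smul_left]
  have hDu : ⟪u, stepSizeOp P S A τ σ u⟫_ℝ
      = ∑ s, P.real (S ⁻¹' {s}) * (τ * ‖extrapolation A p d s‖ ^ 2) := by
    have h1 : stepSizeOp P S A τ σ u = Q ((∑ s, P.real (S ⁻¹' {s}) •
        (restrictedOp C s ∘L ContinuousLinearMap.adjoint (restrictedOp C s))) (Q u)) := by
      rw [← integral_comp_finset hS fun s =>
        restrictedOp C s ∘L ContinuousLinearMap.adjoint (restrictedOp C s)]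
      rfl
    rw [h1, hQself, sum_apply, inner_sum]
    refine Finset.sum_congr rfl fun s _ => ?_
    rw [smul_apply, inner_smul_right, ContinuousLinearMap.comp_apply,
      ← ContinuousLinearMap.adjoint_inner_left, real_inner_self_eq_norm_sq, hCQ, norm_smul,
      mul_pow, Real.norm_of_nonneg (Real.sqrt_nonneg _), Real.sq_sqrt hτ.le]
  have hnorm : ‖u‖ ^ 2 = ∑ i, ‖d i‖ ^ 2 / σ i := by
    rw [PiLp.norm_sq_eq_of_L2]
    refine Finset.sum_congr rfl fun i _ => ?_
    have h1 : u i = (√(σ i))⁻¹ • d i := rfl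
    rw [h1, norm_smul, mul_pow, norm_inv, Real.norm_of_nonneg (Real.sqrt_nonneg _), inv_pow,
      Real.sq_sqrt (hσ i).le]
    ring
  rw [← hDu, ← hnorm]
  calc ⟪u, stepSizeOp P S A τ σ u⟫_ℝ ≤ ‖u‖ * ‖stepSizeOp P S A τ σ u‖ := real_inner_le_norm _ _
    _ ≤ ‖u‖ * (‖stepSizeOp P S A τ σ‖ * ‖u‖) := by
        gcongr; exact ContinuousLinearMap.le_opNorm _ _
    _ = ‖stepSizeOp P S A τ σ‖ * ‖u‖ ^ 2 := by ring

end StepSize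

/-! ### Energy estimate and expected Lyapunov decrease -/

section OneStep

variable {n : ℕ} {X : Type*} [NormedAddCommGroup X] [InnerProductSpace ℝ X] [CompleteSpace X]
  {Y : Fin n → Type*} [∀ i, NormedAddCommGroup (Y i)] [∀ i, InnerProductSpace ℝ (Y i)]
  [∀ i, CompleteSpace (Y i)]

/-- The primal variable after one step. -/
noncomputable def primalStep (g : X → EReal) (τ : ℝ) (w : State X Y) : X :=
  prox (scale τ g) (w.x - τ • w.zbar)

/-- The increment of the dual variable in one step, if all components are updated. -/
noncomputable def dualIncrement (A : ∀ i, X →L[ℝ] Y i) (f : ∀ i, Y i → EReal) (g : X → EReal)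
    (τ : ℝ) (σ : Fin n → ℝ) (w : State X Y) (i : Fin n) : Y i :=
  prox (scale (σ i) (conjugate (f i))) (w.y i + σ i • A i (primalStep g τ w)) - w.y i

/-- The weighted squared distance to `u`, corrected by the extrapolation term. -/
noncomputable def lyapunov (τ : ℝ) (σ p : Fin n → ℝ) (γ : ℝ) (u : X × PiLp 2 Y)
    (w : State X Y) : ℝ :=
  ‖w.x - u.1‖ ^ 2 / (2 * τ) + ∑ i, ‖w.y i - u.2 i‖ ^ 2 / (2 * σ i * p i)
    - ⟪w.x - u.1, w.zbar - w.z⟫_ℝ + τ / (2 * γ) * ‖w.zbar - w.z‖ ^ 2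

/-- The squared length of a full step. -/
noncomputable def stepLength (A : ∀ i, X →L[ℝ] Y i) (f : ∀ i, Y i → EReal) (g : X → EReal)
    (τ : ℝ) (σ : Fin n → ℝ) (w : State X Y) : ℝ :=
  ‖primalStep g τ w - w.x‖ ^ 2 / τ + ∑ i, ‖dualIncrement A f g τ σ w i‖ ^ 2 / σ i

variable {A : ∀ i, X →L[ℝ] Y i} {f : ∀ i, Y i → EReal} {g : X → EReal} {τ : ℝ}
  {σ p : Fin n → ℝ} {γ : ℝ}

omit [CompleteSpace X] in
-- Young's inequality, weighted so that the loss is a fraction `γ` of the primal term.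
theorem inner_le_of_step_size (hτ : 0 < τ) (hγ : 0 < γ) (a b : X) :
    ⟪a, b⟫_ℝ ≤ γ * (‖a‖ ^ 2 / (2 * τ)) + τ / (2 * γ) * ‖b‖ ^ 2 := by
  refine (real_inner_le_norm a b).trans ?_
  have h1 : γ * (‖a‖ ^ 2 / (2 * τ)) + τ / (2 * γ) * ‖b‖ ^ 2 - ‖a‖ * ‖b‖
      = (γ * ‖a‖ - τ * ‖b‖) ^ 2 / (2 * γ * τ) := by
    field_simp
    ring
  have h2 : 0 ≤ (γ * ‖a‖ - τ * ‖b‖) ^ 2 / (2 * γ * τ) := by positivity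
  linarith

omit [CompleteSpace X] [∀ i, CompleteSpace (Y i)] [∀ i, InnerProductSpace ℝ (Y i)] in
-- The last term of `lyapunov` absorbs the inner product at the cost of a fraction `γ` of the primal
-- distance. For `γ < 1` this yields nonnegativity and bounded iterates.
theorem le_lyapunov (hτ : 0 < τ) (hγ : 0 < γ) (u : X × PiLp 2 Y) (w : State X Y) :
    (1 - γ) * (‖w.x - u.1‖ ^ 2 / (2 * τ)) + ∑ i, ‖w.y i - u.2 i‖ ^ 2 / (2 * σ i * p i)
      ≤ lyapunov τ σ p γ u w := by
  have := inner_le_of_step_size hτ hγ (w.x - u.1) (w.zbar - w.z)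
  rw [lyapunov]
  linarith

theorem step_x (θ : ℝ) (s : Finset (Fin n)) (w : State X Y) :
    (step A f g τ σ θ p s w).x = primalStep g τ w := rfl

theorem step_y (θ : ℝ) (s : Finset (Fin n)) (w : State X Y) (i : Fin n) :
    (step A f g τ σ θ p s w).y i
      = if i ∈ s then w.y i + dualIncrement A f g τ σ w i else w.y i := by
  rw [dualIncrement, add_sub_cancel]; rfl

theorem step_y_sub (θ : ℝ) {s : Finset (Fin n)} (w : State X Y) {i : Fin n} (hi : i ∈ s) :
    (step A f g τ σ θ p s w).y i - w.y i = dualIncrement A f g τ σ w i := by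
  rw [step_y, if_pos hi, add_sub_cancel_left]

theorem step_z (θ : ℝ) (s : Finset (Fin n)) (w : State X Y) :
    (step A f g τ σ θ p s w).z = w.z + ∑ i ∈ s,
      ContinuousLinearMap.adjoint (A i) ((step A f g τ σ θ p s w).y i - w.y i) := rfl

theorem step_zbar_sub (s : Finset (Fin n)) (w : State X Y) :
    (step A f g τ σ 1 p s w).zbar - (step A f g τ σ 1 p s w).z
      = extrapolation A p (dualIncrement A f g τ σ w) s := by
  have h1 : (step A f g τ σ 1 p s w).zbar = (step A f g τ σ 1 p s w).z + (1 : ℝ) • ∑ i ∈ s,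
    (p i)⁻¹ • ContinuousLinearMap.adjoint (A i) ((step A f g τ σ 1 p s w).y i - w.y i) := rfl
  rw [h1, one_smul, add_sub_cancel_left, extrapolation]
  exact Finset.sum_congr rfl fun i hi => by rw [step_y_sub 1 w hi]

theorem step_z_eq_adjointSum (θ : ℝ) (s : Finset (Fin n)) {w : State X Y}
    (hw : w.z = adjointSum A w.y) :
    (step A f g τ σ θ p s w).z = adjointSum A (step A f g τ σ θ p s w).y := by
  rw [step_z, hw, adjointSum, adjointSum, Finset.sum_subset (Finset.subset_univ s),
    ← Finset.sum_add_distrib]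
  · simp
  · intro i _ hi
    rw [step_y, if_neg hi, sub_self, map_zero]

theorem inner_sub_sub_eq {E : Type*} [NormedAddCommGroup E] [InnerProductSpace ℝ E] (a b c : E) :
    ⟪a - b, b - c⟫_ℝ = (‖a - c‖ ^ 2 - ‖b - a‖ ^ 2 - ‖b - c‖ ^ 2) / 2 := by
  have h1 : a - c = (a - b) + (b - c) := by abel
  rw [h1, norm_add_sq_real, norm_sub_rev b a]
  ring

/-- The energy estimate of one full step. -/
theorem energy_estimate (hτ : 0 < τ) (hσ : ∀ i, 0 < σ i) (hg : IsProperConvexLSC g)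
    (hf : ∀ i, IsProperConvexLSC (f i)) {u : X × PiLp 2 Y} (hu : IsSaddlePoint A f g u)
    {w : State X Y} (hw : w.z = adjointSum A w.y) :
    ‖primalStep g τ w - u.1‖ ^ 2 / (2 * τ) + ‖primalStep g τ w - w.x‖ ^ 2 / (2 * τ)
      + ∑ i, (‖w.y i + dualIncrement A f g τ σ w i - u.2 i‖ ^ 2 / (2 * σ i)
        + ‖dualIncrement A f g τ σ w i‖ ^ 2 / (2 * σ i))
      - ⟪primalStep g τ w - u.1,
          ∑ i, ContinuousLinearMap.adjoint (A i) (dualIncrement A f g τ σ w i)⟫_ℝ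
      ≤ ‖w.x - u.1‖ ^ 2 / (2 * τ) + ∑ i, ‖w.y i - u.2 i‖ ^ 2 / (2 * σ i)
        - ⟪primalStep g τ w - u.1, w.zbar - w.z⟫_ℝ := by
  obtain ⟨hux, huy⟩ := (isSaddlePoint_iff hg hf).1 hu
  set x' := primalStep g τ w with hx'
  set d := dualIncrement A f g τ σ w with hd
  have hx := (hg.isSubgradient_prox_scale hτ (w.x - τ • w.zbar)).monotone hux
  change 0 ≤ ⟪τ⁻¹ • (w.x - τ • w.zbar - x') - -adjointSum A u.2, x' - u.1⟫_ℝ at hx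
  have h1 : τ⁻¹ • (w.x - τ • w.zbar - x') - -adjointSum A u.2
      = τ⁻¹ • (w.x - x') - (w.zbar - adjointSum A u.2) := by
    rw [sub_right_comm, smul_sub, inv_smul_smul₀ hτ.ne']; abel
  rw [h1, inner_sub_left, real_inner_smul_left, inner_sub_sub_eq] at hx
  have hy : ∀ i, ‖w.y i + d i - u.2 i‖ ^ 2 / (2 * σ i) + ‖d i‖ ^ 2 / (2 * σ i)
      ≤ ‖w.y i - u.2 i‖ ^ 2 / (2 * σ i) + ⟪A i (x' - u.1), w.y i + d i - u.2 i⟫_ℝ := by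
    intro i
    have h2 := ((hf i).conjugate.isSubgradient_prox_scale (hσ i)
      (w.y i + σ i • A i x')).monotone (huy i)
    have h3 : prox (scale (σ i) (conjugate (f i))) (w.y i + σ i • A i x') = w.y i + d i := by
      rw [hd, dualIncrement, add_sub_cancel]
    rw [h3] at h2
    have h4 : (σ i)⁻¹ • (w.y i + σ i • A i x' - (w.y i + d i)) - A i u.1
        = (σ i)⁻¹ • (w.y i - (w.y i + d i)) + A i (x' - u.1) := by
      rw [add_sub_right_comm, smul_add, inv_smul_smul₀ (hσ i).ne', map_sub]; abel
    rw [h4, inner_add_left, real_inner_smul_left, inner_sub_sub_eq, add_sub_cancel_left] at h2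
    have h5 : (σ i)⁻¹ * ((‖w.y i - u.2 i‖ ^ 2 - ‖d i‖ ^ 2 - ‖w.y i + d i - u.2 i‖ ^ 2) / 2)
        = ‖w.y i - u.2 i‖ ^ 2 / (2 * σ i) - ‖d i‖ ^ 2 / (2 * σ i)
          - ‖w.y i + d i - u.2 i‖ ^ 2 / (2 * σ i) := by
      field_simp
    rw [h5] at h2
    linarith
  have hysum := Finset.sum_le_sum fun i (_ : i ∈ Finset.univ) => hy i
  rw [Finset.sum_add_distrib (f := fun i => ‖w.y i - u.2 i‖ ^ 2 / (2 * σ i))] at hysum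
  -- The invariant `w.z = adjointSum A w.y` enters here, so that the coupling terms of the primal
  -- and dual inequalities combine.
  have h6 : ∑ i, ⟪A i (x' - u.1), w.y i + d i - u.2 i⟫_ℝ
      = ⟪x' - u.1, w.z⟫_ℝ
        + ⟪x' - u.1, ∑ i, ContinuousLinearMap.adjoint (A i) (d i)⟫_ℝ
        - ⟪x' - u.1, adjointSum A u.2⟫_ℝ := by
    rw [hw, inner_adjointSum, inner_adjointSum, inner_sum, ← Finset.sum_add_distrib,
      ← Finset.sum_sub_distrib]
    refine Finset.sum_congr rfl fun i _ => ?_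
    rw [ContinuousLinearMap.adjoint_inner_right, inner_sub_right, inner_add_right]
  have h7 : τ⁻¹ * ((‖w.x - u.1‖ ^ 2 - ‖x' - w.x‖ ^ 2 - ‖x' - u.1‖ ^ 2) / 2)
      = ‖w.x - u.1‖ ^ 2 / (2 * τ) - ‖x' - w.x‖ ^ 2 / (2 * τ) - ‖x' - u.1‖ ^ 2 / (2 * τ) := by
    field_simp
  rw [h7, real_inner_comm, inner_sub_right] at hx
  rw [inner_sub_right]
  linarith

variable {Ω : Type*} [MeasurableSpace Ω] {P : Measure Ω} [IsProbabilityMeasure P]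

/-- The expected decrease of the Lyapunov function in one step. -/
theorem sum_prob_mul_lyapunov_step_le (hτ : 0 < τ) (hσ : ∀ i, 0 < σ i)
    (hg : IsProperConvexLSC g) (hf : ∀ i, IsProperConvexLSC (f i))
    {S : Ω → Finset (Fin n)} (hS : Measurable S) (hp : ∀ i, 0 < inclusionProb P S i)
    (hγ : 0 < γ) (hD : ‖stepSizeOp P S A τ σ‖ ≤ γ ^ 2)
    {u : X × PiLp 2 Y} (hu : IsSaddlePoint A f g u)
    {w : State X Y} (hw : w.z = adjointSum A w.y) :
    ∑ s, P.real (S ⁻¹' {s}) * lyapunov τ σ (inclusionProb P S) γ u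
        (step A f g τ σ 1 (inclusionProb P S) s w)
      + (1 - γ) / 2 * stepLength A f g τ σ w
      ≤ lyapunov τ σ (inclusionProb P S) γ u w := by
  set p := inclusionProb P S with hpdef
  set x' := primalStep g τ w with hx'
  set d := dualIncrement A f g τ σ w with hd
  have henergy := energy_estimate hτ hσ hg hf hu hw
  rw [← hx', ← hd] at henergy
  have heso := sum_prob_mul_norm_extrapolation_sq_le (P := P) hS A hτ hσ d
  rw [← hpdef] at heso
  have hdn : 0 ≤ ∑ i, ‖d i‖ ^ 2 / σ i :=
    Finset.sum_nonneg fun i _ => div_nonneg (sq_nonneg _) (hσ i).le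
  set N := ∑ i, ‖d i‖ ^ 2 / σ i with hN
  -- The factor `τ / (2 * γ)` turns `‖D‖ ≤ γ ^ 2` into `γ / 2`, below the `N / 2` that the energy
  -- estimate provides.
  have heso' : ∑ s, P.real (S ⁻¹' {s}) * (τ / (2 * γ) * ‖extrapolation A p d s‖ ^ 2)
      ≤ γ / 2 * N := by
    have h1 : ∑ s, P.real (S ⁻¹' {s}) * (τ / (2 * γ) * ‖extrapolation A p d s‖ ^ 2)
        = (2 * γ)⁻¹ * ∑ s, P.real (S ⁻¹' {s}) * (τ * ‖extrapolation A p d s‖ ^ 2) := by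
      rw [Finset.mul_sum]
      exact Finset.sum_congr rfl fun s _ => by ring
    have h2 : γ / 2 * N = (2 * γ)⁻¹ * (γ ^ 2 * N) := by field_simp
    rw [h1, h2]
    gcongr
    exact heso.trans (by gcongr)
  have hdual : ∀ s, ∑ i, ‖(step A f g τ σ 1 p s w).y i - u.2 i‖ ^ 2 / (2 * σ i * p i)
      = ∑ i, ‖w.y i - u.2 i‖ ^ 2 / (2 * σ i * p i)
        + ∑ i ∈ s, (‖w.y i + d i - u.2 i‖ ^ 2 - ‖w.y i - u.2 i‖ ^ 2) / (2 * σ i * p i) := by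
    intro s
    have h1 : ∀ i, ‖(step A f g τ σ 1 p s w).y i - u.2 i‖ ^ 2 / (2 * σ i * p i)
        = ‖w.y i - u.2 i‖ ^ 2 / (2 * σ i * p i) + if i ∈ s then
          (‖w.y i + d i - u.2 i‖ ^ 2 - ‖w.y i - u.2 i‖ ^ 2) / (2 * σ i * p i) else 0 := by
      intro i
      rw [step_y]
      split_ifs
      · ring
      · rw [add_zero]
    rw [Finset.sum_congr rfl fun i _ => h1 i, Finset.sum_add_distrib, Finset.sum_ite_mem,
      Finset.univ_inter]
  have hlyap : ∀ s, lyapunov τ σ p γ u (step A f g τ σ 1 p s w)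
      = (‖x' - u.1‖ ^ 2 / (2 * τ) + ∑ i, ‖w.y i - u.2 i‖ ^ 2 / (2 * σ i * p i))
        + ∑ i ∈ s, ((‖w.y i + d i - u.2 i‖ ^ 2 - ‖w.y i - u.2 i‖ ^ 2) / (2 * σ i * p i)
          - (p i)⁻¹ * ⟪x' - u.1, ContinuousLinearMap.adjoint (A i) (d i)⟫_ℝ)
        + τ / (2 * γ) * ‖extrapolation A p d s‖ ^ 2 := by
    intro s
    rw [lyapunov, step_zbar_sub, hdual, step_x, Finset.sum_sub_distrib]
    have : ⟪x' - u.1, extrapolation A p d s⟫_ℝ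
        = ∑ i ∈ s, (p i)⁻¹ * ⟪x' - u.1, ContinuousLinearMap.adjoint (A i) (d i)⟫_ℝ := by
      rw [extrapolation, inner_sum]
      exact Finset.sum_congr rfl fun i _ => real_inner_smul_right _ _ _
    rw [this]
    ring
  simp only [hlyap, mul_add, Finset.sum_add_distrib, ← Finset.sum_mul]
  have hmean := sum_prob_smul_sum (P := P) hS fun i =>
    (‖w.y i + d i - u.2 i‖ ^ 2 - ‖w.y i - u.2 i‖ ^ 2) / (2 * σ i * p i)
      - (p i)⁻¹ * ⟪x' - u.1, ContinuousLinearMap.adjoint (A i) (d i)⟫_ℝ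
  simp only [smul_eq_mul] at hmean
  -- The probability cancels both weights: the dual term and the extrapolation term return to their
  -- full-step forms.
  have hmean' : ∀ i, inclusionProb P S i
      * ((‖w.y i + d i - u.2 i‖ ^ 2 - ‖w.y i - u.2 i‖ ^ 2) / (2 * σ i * p i)
        - (p i)⁻¹ * ⟪x' - u.1, ContinuousLinearMap.adjoint (A i) (d i)⟫_ℝ)
      = (‖w.y i + d i - u.2 i‖ ^ 2 / (2 * σ i) - ‖w.y i - u.2 i‖ ^ 2 / (2 * σ i))
        - ⟪x' - u.1, ContinuousLinearMap.adjoint (A i) (d i)⟫_ℝ := by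
    intro i
    have := (hp i).ne'
    have := (hσ i).ne'
    rw [← hpdef]
    field_simp
  rw [hmean, sum_prob_eq_one hS, Finset.sum_congr rfl fun i _ => hmean' i,
    Finset.sum_sub_distrib, Finset.sum_sub_distrib, ← inner_sum]
  have hinner := inner_le_of_step_size hτ hγ (w.x - x') (w.zbar - w.z)
  -- The old extrapolation is tested against `x'` in the estimate but against `w.x` in `lyapunov`;
  -- the discrepancy is paid for by the primal step length.
  have hsplit : ⟪x' - u.1, w.zbar - w.z⟫_ℝ
      = ⟪w.x - u.1, w.zbar - w.z⟫_ℝ - ⟪w.x - x', w.zbar - w.z⟫_ℝ := by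
    rw [← inner_sub_left]; congr 1; abel
  rw [norm_sub_rev w.x x'] at hinner
  have hdhalf : ∑ i, ‖d i‖ ^ 2 / (2 * σ i) = N / 2 := by
    rw [hN, Finset.sum_div]
    exact Finset.sum_congr rfl fun i _ => by field_simp
  have hlen : (1 - γ) / 2 * stepLength A f g τ σ w
      = (1 - γ) * (‖x' - w.x‖ ^ 2 / (2 * τ)) + (1 - γ) / 2 * N := by
    rw [stepLength, ← hx', ← hd, ← hN]
    field_simp
  rw [Finset.sum_add_distrib, hdhalf, hsplit] at henergy
  rw [hlen, lyapunov]
  linarith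

end OneStep

/-! ### Weak convergence of a single trajectory -/

section Trajectories

variable {n : ℕ} {X : Type*} [NormedAddCommGroup X] [InnerProductSpace ℝ X] [CompleteSpace X]
  {Y : Fin n → Type*} [∀ i, NormedAddCommGroup (Y i)] [∀ i, InnerProductSpace ℝ (Y i)]
  [∀ i, CompleteSpace (Y i)]
  {A : ∀ i, X →L[ℝ] Y i} {f : ∀ i, Y i → EReal} {g : X → EReal} {τ : ℝ}
  {σ p : Fin n → ℝ} {γ : ℝ}

theorem WeakTendsto.const_smul {E : Type*} [NormedAddCommGroup E] [NormedSpace ℝ E] {v : ℕ → E}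
    {v' : E} (hv : WeakTendsto v v') (c : ℝ) : WeakTendsto (fun k => c • v k) (c • v') := by
  simpa using hv.clm (c • ContinuousLinearMap.id ℝ E)

theorem WeakTendsto.adjointSum {y : ℕ → PiLp 2 Y} {y' : PiLp 2 Y} (hy : WeakTendsto y y') :
    WeakTendsto (fun k => adjointSum A (y k)) (adjointSum A y') := by
  refine weakTendsto_iff_inner.2 fun u => ?_
  simp only [inner_adjointSum]
  exact tendsto_finsetSum _ fun i _ =>
    weakTendsto_iff_inner.1 (hy.clm (PiLp.proj 2 Y i)) (A i u)

/-- The weighted inner product of `X × Y` underlying the Lyapunov function. -/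
noncomputable def weightedInner (X : Type*) [NormedAddCommGroup X] [InnerProductSpace ℝ X]
    (Y : Fin n → Type*) [∀ i, NormedAddCommGroup (Y i)] [∀ i, InnerProductSpace ℝ (Y i)]
    (τ : ℝ) (σ p : Fin n → ℝ) :
    X × PiLp 2 Y →L[ℝ] X × PiLp 2 Y →L[ℝ] ℝ :=
  (2 * τ)⁻¹ • (innerSL ℝ).bilinearComp (ContinuousLinearMap.fst ℝ X (PiLp 2 Y))
      (ContinuousLinearMap.fst ℝ X (PiLp 2 Y))
    + ∑ i, (2 * σ i * p i)⁻¹ • (innerSL ℝ).bilinearComp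
        (PiLp.proj 2 Y i ∘L ContinuousLinearMap.snd ℝ X (PiLp 2 Y))
        (PiLp.proj 2 Y i ∘L ContinuousLinearMap.snd ℝ X (PiLp 2 Y))

omit [CompleteSpace X] [∀ i, CompleteSpace (Y i)] in
theorem weightedInner_self (u : X × PiLp 2 Y) :
    weightedInner X Y τ σ p u u = ‖u.1‖ ^ 2 / (2 * τ) + ∑ i, ‖u.2 i‖ ^ 2 / (2 * σ i * p i) := by
  have h1 : weightedInner X Y τ σ p u u
      = (2 * τ)⁻¹ * ⟪u.1, u.1⟫_ℝ + ∑ i, (2 * σ i * p i)⁻¹ * ⟪u.2 i, u.2 i⟫_ℝ := by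
    simp only [weightedInner, add_apply, sum_apply, smul_apply]
    rfl
  simp only [h1, real_inner_self_eq_norm_sq, div_eq_inv_mul]

omit [CompleteSpace X] [∀ i, CompleteSpace (Y i)] in
theorem eq_zero_of_weightedInner_self (hτ : 0 < τ) (hσ : ∀ i, 0 < σ i) (hp : ∀ i, 0 < p i)
    (u : X × PiLp 2 Y) (hu : weightedInner X Y τ σ p u u = 0) : u = 0 := by
  rw [weightedInner_self] at hu
  have h1 : ∀ i, 0 ≤ ‖u.2 i‖ ^ 2 / (2 * σ i * p i) := fun i => by
    have := hσ i; have := hp i; positivity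
  have h2 : 0 ≤ ∑ i, ‖u.2 i‖ ^ 2 / (2 * σ i * p i) := Finset.sum_nonneg fun i _ => h1 i
  have h3 : 0 ≤ ‖u.1‖ ^ 2 / (2 * τ) := by positivity
  have h4 : ‖u.1‖ ^ 2 / (2 * τ) = 0 := by linarith
  have h5 := (Finset.sum_eq_zero_iff_of_nonneg fun i _ => h1 i).1
    (by linarith : ∑ i, ‖u.2 i‖ ^ 2 / (2 * σ i * p i) = 0)
  refine Prod.ext ?_ (PiLp.ext fun i => ?_)
  · simpa [hτ.ne'] using h4
  · simpa [(hσ i).ne', (hp i).ne'] using h5 i (Finset.mem_univ i)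

theorem norm_extrapolation_le (d : ∀ i, Y i) (s : Finset (Fin n)) :
    ‖extrapolation A p d s‖
      ≤ ∑ i, ‖(p i)⁻¹‖ * (‖ContinuousLinearMap.adjoint (A i)‖ * ‖d i‖) := by
  refine (norm_sum_le _ _).trans ((Finset.sum_le_sum fun i _ => ?_).trans
    (Finset.sum_le_sum_of_subset_of_nonneg (Finset.subset_univ s) fun i _ _ => by positivity))
  rw [norm_smul]
  gcongr
  exact ContinuousLinearMap.le_opNorm _ _

/-- Weak cluster points of a sequence of states with vanishing step lengths are saddle points. -/
theorem isSaddlePoint_of_weakTendsto (hτ : 0 < τ) (hσ : ∀ i, 0 < σ i)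
    (hg : IsProperConvexLSC g) (hf : ∀ i, IsProperConvexLSC (f i))
    (hproxg : WeaklySeqContinuous (prox (scale τ g)))
    (hproxf : ∀ i, WeaklySeqContinuous (prox (scale (σ i) (conjugate (f i)))))
    {w : ℕ → State X Y} (hz : ∀ k, (w k).z = adjointSum A (w k).y)
    (he : Tendsto (fun k => (w k).zbar - (w k).z) atTop (𝓝 0))
    (hx : Tendsto (fun k => primalStep g τ (w k) - (w k).x) atTop (𝓝 0))
    (hd : ∀ i, Tendsto (fun k => dualIncrement A f g τ σ (w k) i) atTop (𝓝 0))
    {u : X × PiLp 2 Y} (hux : WeakTendsto (fun k => (w k).x) u.1)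
    (huy : WeakTendsto (fun k => (w k).y) u.2) : IsSaddlePoint A f g u := by
  have hprimal : WeakTendsto (fun k => primalStep g τ (w k)) u.1 := by
    have := hux.add_tendsto_zero hx
    simpa using this
  have hzbar : WeakTendsto (fun k => (w k).zbar) (adjointSum A u.2) := by
    have := (huy.adjointSum (A := A)).add_tendsto_zero he
    simpa [hz] using this
  -- The primal steps converge weakly both to the proximal image of the limit and, as increments
  -- vanish, to `u.1` itself.
  have hfixx : prox (scale τ g) (u.1 - τ • adjointSum A u.2) = u.1 :=
    (hproxg _ _ (hux.sub (hzbar.const_smul τ))).unique hprimal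
  have huyi : ∀ i, WeakTendsto (fun k => (w k).y i) (u.2 i) := fun i =>
    huy.clm (PiLp.proj 2 Y i)
  have hfixy : ∀ i, prox (scale (σ i) (conjugate (f i))) (u.2 i + σ i • A i u.1) = u.2 i := by
    intro i
    have h1 := hproxf i _ _ ((huyi i).add ((hprimal.clm (A i)).const_smul (σ i)))
    refine h1.unique ?_
    have h2 := (huyi i).add_tendsto_zero (hd i)
    simpa [dualIncrement] using h2
  refine (isSaddlePoint_iff hg hf).2 ⟨?_, fun i => ?_⟩
  · have := hg.isSubgradient_prox_scale hτ (u.1 - τ • adjointSum A u.2)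
    rwa [hfixx, sub_sub_cancel_left, smul_neg, inv_smul_smul₀ hτ.ne'] at this
  · have := (hf i).conjugate.isSubgradient_prox_scale (hσ i) (u.2 i + σ i • A i u.1)
    rwa [hfixy, add_sub_cancel_left, inv_smul_smul₀ (hσ i).ne'] at this

variable [TopologicalSpace.SeparableSpace X] [∀ i, TopologicalSpace.SeparableSpace (Y i)]

/-- A trajectory with convergent Lyapunov functions and vanishing step lengths converges weakly to
a saddle point. -/
theorem exists_weakTendsto_isSaddlePoint (hτ : 0 < τ) (hσ : ∀ i, 0 < σ i) (hp : ∀ i, 0 < p i)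
    (hγ : 0 < γ) (hγ1 : γ < 1)
    (hg : IsProperConvexLSC g) (hf : ∀ i, IsProperConvexLSC (f i))
    (hproxg : WeaklySeqContinuous (prox (scale τ g)))
    (hproxf : ∀ i, WeaklySeqContinuous (prox (scale (σ i) (conjugate (f i)))))
    {s : ℕ → Finset (Fin n)} {w : ℕ → State X Y}
    (hstep : ∀ k, w (k + 1) = step A f g τ σ 1 p (s k) (w k))
    (hz : ∀ k, (w k).z = adjointSum A (w k).y)
    {D : Set (X × PiLp 2 Y)} (hDne : D.Nonempty)
    (hD : {u | IsSaddlePoint A f g u} ⊆ closure D)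
    (hlyap : ∀ u ∈ D, ∃ l, Tendsto (fun k => lyapunov τ σ p γ u (w k)) atTop (𝓝 l))
    (hlen : Tendsto (fun k => stepLength A f g τ σ (w k)) atTop (𝓝 0)) :
    ∃ u, IsSaddlePoint A f g u ∧ WeakTendsto (fun k => ((w k).x, (w k).y)) u := by
  have hdterm : ∀ v i, 0 ≤ ‖dualIncrement A f g τ σ v i‖ ^ 2 / σ i := fun v i =>
    div_nonneg (sq_nonneg _) (hσ i).le
  have hxlim : Tendsto (fun k => primalStep g τ (w k) - (w k).x) atTop (𝓝 0) := by
    rw [tendsto_zero_iff_norm_tendsto_zero]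
    have h1 : Tendsto (fun k => √(τ * stepLength A f g τ σ (w k))) atTop (𝓝 0) := by
      simpa using (hlen.const_mul τ).sqrt
    refine squeeze_zero (fun k => norm_nonneg _) (fun k => Real.le_sqrt_of_sq_le ?_) h1
    rw [stepLength, mul_add, mul_div_cancel₀ _ hτ.ne']
    have := mul_nonneg hτ.le (Finset.sum_nonneg fun i (_ : i ∈ Finset.univ) => hdterm (w k) i)
    linarith
  have hdlim : ∀ i, Tendsto (fun k => dualIncrement A f g τ σ (w k) i) atTop (𝓝 0) := by
    intro i
    rw [tendsto_zero_iff_norm_tendsto_zero]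
    have h1 : Tendsto (fun k => √(σ i * stepLength A f g τ σ (w k))) atTop (𝓝 0) := by
      simpa using (hlen.const_mul (σ i)).sqrt
    refine squeeze_zero (fun k => norm_nonneg _) (fun k => Real.le_sqrt_of_sq_le ?_) h1
    have h2 := Finset.single_le_sum (fun i _ => hdterm (w k) i) (Finset.mem_univ i)
    have h3 : 0 ≤ ‖primalStep g τ (w k) - (w k).x‖ ^ 2 / τ := by positivity
    have h4 : ‖dualIncrement A f g τ σ (w k) i‖ ^ 2 / σ i ≤ stepLength A f g τ σ (w k) := by
      rw [stepLength]; linarith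
    rwa [div_le_iff₀' (hσ i)] at h4
  have helim : Tendsto (fun k => (w k).zbar - (w k).z) atTop (𝓝 0) := by
    -- Only after a step is `zbar - z` known to be an extrapolation term, hence the shift by one.
    rw [← tendsto_add_atTop_iff_nat 1]
    simp only [hstep, step_zbar_sub]
    refine squeeze_zero_norm (fun k => norm_extrapolation_le _ _) ?_
    have h1 : Tendsto (fun k => ∑ i, ‖(p i)⁻¹‖ * (‖ContinuousLinearMap.adjoint (A i)‖
        * ‖dualIncrement A f g τ σ (w k) i‖)) atTop
        (𝓝 (∑ i, ‖(p i)⁻¹‖ * (‖ContinuousLinearMap.adjoint (A i)‖ * ‖(0 : Y i)‖))) :=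
      tendsto_finsetSum _ fun i _ => ((hdlim i).norm.const_mul _).const_mul _
    simpa using h1
  have hterm : ∀ (u : X × PiLp 2 Y) (v : State X Y) i,
      0 ≤ ‖v.y i - u.2 i‖ ^ 2 / (2 * σ i * p i) := fun u v i => by
    have := hσ i; have := hp i; positivity
  obtain ⟨u₀, hu₀⟩ := hDne
  obtain ⟨l₀, hl₀⟩ := hlyap u₀ hu₀
  obtain ⟨M, hM⟩ := hl₀.bddAbove_range
  have hM' : ∀ k, lyapunov τ σ p γ u₀ (w k) ≤ M := fun k => hM ⟨k, rfl⟩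
  have hxbdd : ∀ k, ‖(w k).x‖ ≤ √(2 * τ * M / (1 - γ)) + ‖u₀.1‖ := by
    intro k
    have h1 := le_lyapunov (σ := σ) (p := p) hτ hγ u₀ (w k)
    have h2 := Finset.sum_nonneg fun i (_ : i ∈ Finset.univ) => hterm u₀ (w k) i
    have h3 : (1 - γ) * (‖(w k).x - u₀.1‖ ^ 2 / (2 * τ)) ≤ M := by linarith [hM' k]
    have h4 : ‖(w k).x - u₀.1‖ ≤ √(2 * τ * M / (1 - γ)) := by
      refine Real.le_sqrt_of_sq_le ?_
      rw [le_div_iff₀ (sub_pos.2 hγ1)]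
      have h5 := mul_le_mul_of_nonneg_left h3 (by positivity : 0 ≤ 2 * τ)
      have h6 : 2 * τ * ((1 - γ) * (‖(w k).x - u₀.1‖ ^ 2 / (2 * τ)))
          = ‖(w k).x - u₀.1‖ ^ 2 * (1 - γ) := by field_simp
      linarith
    linarith [norm_le_norm_sub_add (w k).x u₀.1]
  have hybdd : ∀ k, ‖(w k).y‖ ≤ √(∑ i, 2 * σ i * p i * M) + ‖u₀.2‖ := by
    intro k
    have h1 := le_lyapunov (σ := σ) (p := p) hτ hγ u₀ (w k)
    have h2 : 0 ≤ (1 - γ) * (‖(w k).x - u₀.1‖ ^ 2 / (2 * τ)) :=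
      mul_nonneg (sub_pos.2 hγ1).le (by positivity)
    have h3 : ‖(w k).y - u₀.2‖ ≤ √(∑ i, 2 * σ i * p i * M) := by
      refine Real.le_sqrt_of_sq_le ?_
      rw [PiLp.norm_sq_eq_of_L2]
      refine Finset.sum_le_sum fun i _ => ?_
      have h4 := Finset.single_le_sum (fun i _ => hterm u₀ (w k) i) (Finset.mem_univ i)
      have h5 : ‖(w k).y i - u₀.2 i‖ ^ 2 / (2 * σ i * p i) ≤ M := by linarith [hM' k]
      rwa [div_le_iff₀' (by have := hσ i; have := hp i; positivity)] at h5
    linarith [norm_le_norm_sub_add (w k).y u₀.2]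
  refine exists_weakTendsto_of_tendsto_bilin (B := weightedInner X Y τ σ p)
    (F := {u | IsSaddlePoint A f g u}) (eq_zero_of_weightedInner_self hτ hσ hp) hD ?_ ?_
  · intro u hu
    obtain ⟨l, hl⟩ := hlyap u hu
    -- Since `x` is bounded and `zbar - z → 0`, the correction terms vanish and the weighted
    -- distances inherit the limit of `lyapunov`.
    have h1 : Tendsto (fun k => ⟪(w k).x - u.1, (w k).zbar - (w k).z⟫_ℝ) atTop (𝓝 0) := by
      have h2 := helim.norm.const_mul (√(2 * τ * M / (1 - γ)) + ‖u₀.1‖ + ‖u.1‖)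
      rw [norm_zero, mul_zero] at h2
      refine squeeze_zero_norm (fun k => (norm_inner_le_norm _ _).trans ?_) h2
      gcongr
      exact (norm_sub_le _ _).trans (by linarith [hxbdd k])
    have h3 := (helim.norm.pow 2).const_mul (τ / (2 * γ))
    refine ⟨_, ((hl.add h1).sub h3).congr fun k => ?_⟩
    rw [weightedInner_self, lyapunov]
    simp only [Prod.fst_sub, Prod.snd_sub, PiLp.sub_apply]
    ring
  · intro φ hφ
    obtain ⟨x', ψ, hψ, hx'⟩ := exists_weakTendsto_subseq (v := fun k => (w (φ k)).x)
      fun k => hxbdd (φ k)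
    obtain ⟨y', ψ', hψ', hy'⟩ := exists_weakTendsto_subseq (v := fun k => (w (φ (ψ k))).y)
      fun k => hybdd (φ (ψ k))
    have hψψ' : Tendsto (fun k => ψ (ψ' k)) atTop atTop := hψ.tendsto_atTop.comp hψ'.tendsto_atTop
    have hφψ : Tendsto (fun k => φ (ψ (ψ' k))) atTop atTop := hφ.comp hψψ'
    have hx'' := hx'.comp hψ'.tendsto_atTop
    refine ⟨fun k => ψ (ψ' k), hψψ', (x', y'), ?_, hx''.prodMk hy'⟩
    exact isSaddlePoint_of_weakTendsto (w := fun k => w (φ (ψ (ψ' k)))) hτ hσ hg hf hproxg hproxf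
      (fun k => hz _) (helim.comp hφψ) (hxlim.comp hφψ) (fun i => (hdlim i).comp hφψ) hx'' hy'

end Trajectories

/-! ### Measurable choice of the limit -/

/-- A function with values almost everywhere in the set of weak limits of a sequence of strongly
measurable functions can be chosen strongly measurable and with values in a prescribed set. -/
theorem exists_stronglyMeasurable_weakTendsto {Ω : Type*} [MeasurableSpace Ω] {P : Measure Ω}
    {E F : Type*} [NormedAddCommGroup E] [InnerProductSpace ℝ E] [CompleteSpace E]
    [TopologicalSpace.SeparableSpace E] [NormedAddCommGroup F] [InnerProductSpace ℝ F]
    [CompleteSpace F] [TopologicalSpace.SeparableSpace F]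
    {v : ℕ → Ω → E × F} (hv : ∀ k, StronglyMeasurable (v k)) {K : Set (E × F)} (hK : K.Nonempty)
    (h : ∀ᵐ ω ∂P, ∃ u ∈ K, WeakTendsto (fun k => v k ω) u) :
    ∃ w : Ω → E × F, StronglyMeasurable w ∧ (∀ ω, w ω ∈ K) ∧
      ∀ᵐ ω ∂P, WeakTendsto (fun k => v k ω) (w ω) := by
  classical
  obtain ⟨u₀, hu₀⟩ := hK
  have hex : ∀ ω, ∃ u ∈ K, (∃ u ∈ K, WeakTendsto (fun k => v k ω) u) →
      WeakTendsto (fun k => v k ω) u := by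
    intro ω
    by_cases hω : ∃ u ∈ K, WeakTendsto (fun k => v k ω) u
    · exact ⟨hω.choose, hω.choose_spec.1, fun _ => hω.choose_spec.2⟩
    · exact ⟨u₀, hu₀, fun h => absurd h hω⟩
  choose l hlK hl using hex
  have hlim : ∀ᵐ ω ∂P, WeakTendsto (fun k => v k ω) (l ω) := h.mono fun ω hω => hl ω hω
  have hfst : AEStronglyMeasurable (fun ω => (l ω).1) P :=
    aestronglyMeasurable_of_weakTendsto (fun k => (hv k).fst.aestronglyMeasurable)
      (hlim.mono fun ω hω => hω.clm (ContinuousLinearMap.fst ℝ E F))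
  have hsnd : AEStronglyMeasurable (fun ω => (l ω).2) P :=
    aestronglyMeasurable_of_weakTendsto (fun k => (hv k).snd.aestronglyMeasurable)
      (hlim.mono fun ω hω => hω.clm (ContinuousLinearMap.snd ℝ E F))
  have hm : AEStronglyMeasurable l P := hfst.prodMk hsnd
  -- The measurable version may leave `K` where it differs from `l`. On a measurable null set
  -- containing those points it is replaced by `u₀`.
  set N := toMeasurable P {ω | l ω ≠ hm.mk l ω} with hN
  have hNmeas : MeasurableSet N := measurableSet_toMeasurable _ _
  have hNzero : P N = 0 := by rw [hN, measure_toMeasurable]; exact hm.ae_eq_mk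
  have hmem : ∀ ω, ω ∉ N → l ω = hm.mk l ω := fun ω hω => by
    by_contra hne
    exact hω (subset_toMeasurable P _ hne)
  refine ⟨N.piecewise (fun _ => u₀) (hm.mk l),
    stronglyMeasurable_const.piecewise hNmeas hm.stronglyMeasurable_mk, fun ω => ?_, ?_⟩
  · by_cases hω : ω ∈ N
    · rwa [Set.piecewise_eq_of_mem _ _ _ hω]
    · rw [Set.piecewise_eq_of_notMem _ _ _ hω, ← hmem ω hω]; exact hlK ω
  · filter_upwards [hlim, measure_eq_zero_iff_ae_notMem.1 hNzero] with ω h1 h2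
    rwa [Set.piecewise_eq_of_notMem _ _ _ h2, ← hmem ω h2]

end SPDHG

/-! ### The convergence theorem -/

theorem theorem1 {n : ℕ}
    {X : Type*} [NormedAddCommGroup X] [InnerProductSpace ℝ X] [CompleteSpace X]
    [TopologicalSpace.SeparableSpace X]
    {Y : Fin n → Type*} [∀ i, NormedAddCommGroup (Y i)] [∀ i, InnerProductSpace ℝ (Y i)]
    [∀ i, CompleteSpace (Y i)] [∀ i, TopologicalSpace.SeparableSpace (Y i)]
    {Ω : Type*} [MeasurableSpace Ω] (P : Measure Ω) [IsProbabilityMeasure P]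
    (A : ∀ i, X →L[ℝ] Y i) (f : ∀ i, Y i → EReal) (g : X → EReal)
    (τ : ℝ) (hτ : 0 < τ) (σ : Fin n → ℝ) (hσ : ∀ i, 0 < σ i)
    -- the functionals and the problem
    (hg : SPDHG.IsProperConvexLSC g) (hf : ∀ i, SPDHG.IsProperConvexLSC (f i))
    (hsaddle : ∃ w, SPDHG.IsSaddlePoint A f g w)
    (hproxg : SPDHG.WeaklySeqContinuous (SPDHG.prox (SPDHG.scale τ g)))
    (hproxf : ∀ i, SPDHG.WeaklySeqContinuous
      (SPDHG.prox (SPDHG.scale (σ i) (SPDHG.conjugate (f i)))))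
    -- the sampling: independent, identically distributed, proper
    (S : ℕ → Ω → Finset (Fin n)) (hSmeas : ∀ k, Measurable (S k))
    (hSindep : iIndepFun S P) (hSident : ∀ k, IdentDistrib (S k) (S 0) P P)
    (hSproper : ∀ i, 0 < SPDHG.inclusionProb P (S 0) i)
    -- the step size condition
    (hD : ‖SPDHG.stepSizeOp P (S 0) A τ σ‖ < 1)
    -- the starting point
    (x₀ : X) (y₀ : PiLp 2 Y) :
    ∃ w : Ω → X × PiLp 2 Y, StronglyMeasurable w ∧ (∀ ω, SPDHG.IsSaddlePoint A f g (w ω)) ∧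
      ∀ᵐ ω ∂P, SPDHG.WeakTendsto
        (fun k =>
          let W := SPDHG.iterate A f g τ σ 1 (SPDHG.inclusionProb P (S 0)) x₀ y₀
            (fun j => S j ω) k
          (W.x, W.y))
        (w ω) := by
  classical
  set p := SPDHG.inclusionProb P (S 0)
  set Z : ℕ → Ω → SPDHG.State X Y := fun k ω =>
    SPDHG.iterate A f g τ σ 1 p x₀ y₀ (fun j => S j ω) k
  have hZ0 : ∀ ω, Z 0 ω = SPDHG.initState A x₀ y₀ := fun _ => rfl
  have hZ : ∀ k ω, Z (k + 1) ω = SPDHG.step A f g τ σ 1 p (S k ω) (Z k ω) := fun _ _ => rfl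
  have hz : ∀ k ω, (Z k ω).z = SPDHG.adjointSum A (Z k ω).y := by
    intro k ω
    induction k with
    | zero => rfl
    | succ k ih => rw [hZ]; exact SPDHG.step_z_eq_adjointSum 1 _ ih
  obtain ⟨γ, hγ, hγ1, hDγ⟩ : ∃ γ : ℝ, 0 < γ ∧ γ < 1 ∧
      ‖SPDHG.stepSizeOp P (S 0) A τ σ‖ ≤ γ ^ 2 := by
    have h0 := norm_nonneg (SPDHG.stepSizeOp P (S 0) A τ σ)
    -- The midpoint of `‖D‖` and `1` keeps `γ` positive even when `D = 0`, as required for division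
    -- by `γ`.
    refine ⟨√((1 + ‖SPDHG.stepSizeOp P (S 0) A τ σ‖) / 2), by positivity, ?_, ?_⟩
    · rw [Real.sqrt_lt' one_pos]; linarith
    · rw [Real.sq_sqrt (by positivity)]; linarith
  obtain ⟨D, hDsub, hDcount, hDdense⟩ := (TopologicalSpace.IsSeparable.of_separableSpace
    {u | SPDHG.IsSaddlePoint A f g u}).exists_countable_dense_subset
  have hDne : D.Nonempty := by
    obtain ⟨u, hu⟩ := hsaddle
    exact closure_nonempty_iff.1 ⟨u, hDdense hu⟩
  have hlen : ∀ v, 0 ≤ SPDHG.stepLength A f g τ σ v := fun v =>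
    add_nonneg (by positivity) (Finset.sum_nonneg fun i _ =>
      div_nonneg (sq_nonneg _) (hσ i).le)
  have hlyap : ∀ᵐ ω ∂P, ∀ u ∈ D,
      (∃ l, Tendsto (fun k => SPDHG.lyapunov τ σ p γ u (Z k ω)) atTop (𝓝 l)) ∧
      Tendsto (fun k => (1 - γ) / 2 * SPDHG.stepLength A f g τ σ (Z k ω)) atTop (𝓝 0) := by
    refine (ae_ball_iff hDcount).2 fun u hu => ?_
    refine SPDHG.ae_tendsto_randomIteration hSmeas hSindep hSident hZ0 hZ
      (V := SPDHG.lyapunov τ σ p γ u)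
      (D := fun v => (1 - γ) / 2 * SPDHG.stepLength A f g τ σ v)
      (I := fun v => v.z = SPDHG.adjointSum A v.y) rfl
      (fun s v hv => SPDHG.step_z_eq_adjointSum 1 s hv) (fun v _ => ?_)
      (fun v => mul_nonneg (by linarith) (hlen v)) (fun v hv => ?_)
    · refine le_trans ?_ (SPDHG.le_lyapunov hτ hγ u v)
      refine add_nonneg (mul_nonneg (by linarith) (by positivity))
        (Finset.sum_nonneg fun i _ => ?_)
      have := hσ i
      have : 0 < p i := hSproper i
      positivity
    · exact SPDHG.sum_prob_mul_lyapunov_step_le hτ hσ hg hf (hSmeas 0) hSproper hγ hDγ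
        (hDsub hu) hv
  refine SPDHG.exists_stronglyMeasurable_weakTendsto (K := {u | SPDHG.IsSaddlePoint A f g u})
    (fun k => ?_) hsaddle ?_
  · exact (SPDHG.stronglyMeasurable_comp_randomIteration hSmeas hZ0 hZ k
      fun v => (v.x, v.y)).mono ((SPDHG.pastFiltration hSmeas).le k)
  · filter_upwards [hlyap] with ω hω
    obtain ⟨u₀, hu₀⟩ := hDne
    have hlim : Tendsto (fun k => SPDHG.stepLength A f g τ σ (Z k ω)) atTop (𝓝 0) := by
      have h1 := (hω u₀ hu₀).2.const_mul ((1 - γ) / 2)⁻¹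
      rw [mul_zero] at h1
      exact h1.congr fun k => inv_mul_cancel_left₀ (by linarith) _
    exact SPDHG.exists_weakTendsto_isSaddlePoint hτ hσ hSproper hγ hγ1 hg hf hproxg hproxf
      (fun k => hZ k ω) (fun k => hz k ω) ⟨u₀, hu₀⟩ hDdense (fun u hu => (hω u hu).1) hlim
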